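/- **Setting.** Let $\mathfrak g=\mathfrak g_{\bar 0}\oplus\mathfrak g_{\bar 1}$ be a classical Lie superalgebra: a finite-dimensional Lie superalgebra over $\mathbb C$ with a connected reductive algebraic group $G_{\bar 0}$ such that $\operatorname{Lie}G_{\bar 0}=\mathfrak g_{\bar 0}$, acting on $\mathfrak g$ by automorphisms (by the adjoint action on $\mathfrak g_{\bar 0}$, and rationally on $\mathfrak g_{\bar 1}$ with differential the adjoint action of $\mathfrak g_{\bar 0}$ on $\mathfrak g_{\bar 1}$). Let $T_{\bar 0}\subseteq G_{\bar 0}$ be a maximal torus, $\mathfrak t_{\bar 0}=\operatorname{Lie}T_{\bar 0}$, and write $\mathfrak g_{\bar 0}^{\alpha},\mathfrak g_{\bar 1}^{\alpha}$ ($\alpha\in\mathfrak t_{\bar 0}^*$) for the weight spaces. *Detecting subalgebra.* Let $x_0\in\mathfrak g_{\bar 1}$, $H=\operatorname{Stab}_{G_{\bar 0}}(x_0)$, $\mathfrak f_{\bar 1}=\mathfrak g_{\bar 1}^{H}$, $\mathfrak f_{\bar 0}=[\mathfrak f_{\bar 1},\mathfrak f_{\bar 1}]$ and $\mathfrak f=\mathfrak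 f_{\bar 0}\oplus\mathfrak f_{\bar 1}$. Assume that $\mathfrak f_{\bar 0}\subseteq\mathfrak t_{\bar 0}$ and that $\mathfrak f_{\bar 1}$ is $T_{\bar 0}$-stable. *Parabolic subalgebra.* Let $\mathcal H$ be a linear functional on the real span of the weights, extended to an $\mathbb R$-linear functional on $\mathfrak t_{\bar 0}^*$, such that no root of $\mathfrak g_{\bar 0}$ lies on the hyperplane $\ker\mathcal H$ and $\mathfrak f_{\bar 1}=\sum_{\mathcal H(\alpha)=0}\mathfrak g_{\bar 1}^{\alpha}$. Put $$\mathfrak t=\mathfrak t_{\bar 0}\oplus\mathfrak f_{\bar 1},\qquad \mathfrak u_{i}=\sum_{\mathcal H(\alpha)<0}\mathfrak g_{i}^{\alpha}\ (i=\bar 0,\bar 1),\qquad \mathfrak u=\mathfrak u_{\bar 0}\oplus\mathfrak u_{\bar 1},\qquad \mathfrak b=\mathfrak t\oplus\mathfrak u .$$ Then $\mathfrak b$ is a subalgebra with $\mathfrak b_{\bar 0}=\mathfrak t_{\bar 0}\oplus\mathfrak u_{\bar 0}$, $\mathfrak b_{\bar 1}=\mathfrak f_{\bar 1}\oplus\mathfrak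 u_{\bar 1}$, and $\mathfrak f\subseteq\mathfrak t\subseteq\mathfrak b$. *Cohomology.* For a Lie superalgebra $\mathfrak a$, $\operatorname H^\bullet(\mathfrak a,\mathfrak a_{\bar 0},\mathbb C)$ denotes relative cohomology, i.e. the cohomology of the complex $C^n=\operatorname{Hom}_{\mathfrak a_{\bar 0}}(\Lambda_s^n(\mathfrak a/\mathfrak a_{\bar 0}),\mathbb C)$ ($\Lambda_s$ the super exterior power) with the usual differential and cup product. **Theorem.** In this setting: (a) There is an isomorphism of graded algebras $\operatorname H^\bullet(\mathfrak f,\mathfrak f_{\bar 0},\mathbb C)\cong S^\bullet(\mathfrak f_{\bar 1}^*)$. (b) In every degree, the restriction map $\operatorname H^\bullet(\mathfrak b,\mathfrak b_{\bar 0},\mathbb C)\to\operatorname H^\bullet(\mathfrak f,\mathfrak f_{\bar 0},\mathbb C)$ is injective with image $\operatorname H^\bullet(\mathfrak f,\mathfrak f_{\bar 0},\mathbb C)^{T_{\bar 0}}$, and it respects products. Hence it is an isomorphism of graded algebras $\operatorname H^\bullet(\mathfrak b,\mathfrak b_{\bar 0},\mathbb C)\to\operatorname H^\bullet(\mathfrak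 f,\mathfrak f_{\bar 0},\mathbb C)^{T_{\bar 0}}$. -/

import Mathlib

universe u

noncomputable section

/-! ## Lie superalgebras over `ℂ` -/

/-- A Lie superalgebra over `ℂ`, written out through its homogeneous components: a Lie algebra
`even`, an `even`-module `odd`, and a symmetric bilinear bracket `odd × odd → even` that satisfies
the two remaining cases of the super Jacobi identity (one even and two odd entries; three odd
entries).  The bracket of an even and an odd element is `[X, x] = ⁅X, x⁆ = -[x, X]`. -/
structure LieSuperalgebra : Type (u + 1) where
  even : Type u
  odd : Type u
  [evenLieRing : LieRing even]
  [evenLieAlgebra : LieAlgebra ℂ even]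
  [oddAddCommGroup : AddCommGroup odd]
  [oddModule : Module ℂ odd]
  [oddLieRingModule : LieRingModule even odd]
  [oddLieModule : LieModule ℂ even odd]
  br : odd →ₗ[ℂ] odd →ₗ[ℂ] even
  br_symm : ∀ x y : odd, br x y = br y x
  lie_br : ∀ (X : even) (x y : odd), ⁅X, br x y⁆ = br ⁅X, x⁆ y + br x ⁅X, y⁆
  jacobi : ∀ x y z : odd, ⁅br x y, z⁆ + ⁅br y z, x⁆ + ⁅br z x, y⁆ = 0

namespace LieSuperalgebra

attribute [instance] evenLieRing evenLieAlgebra oddAddCommGroup oddModule oddLieRingModule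
  oddLieModule

/-- The full superbracket on `𝔞 = 𝔞₀ ⊕ 𝔞₁`. -/
def bracket (𝔞 : LieSuperalgebra.{u}) (a b : 𝔞.even × 𝔞.odd) : 𝔞.even × 𝔞.odd :=
  (⁅a.1, b.1⁆ + 𝔞.br a.2 b.2, ⁅a.1, b.2⁆ - ⁅b.1, a.2⁆)

/-- (Even) homomorphisms of Lie superalgebras. -/
structure Hom (𝔞 𝔟 : LieSuperalgebra.{u}) where
  even : 𝔞.even →ₗ⁅ℂ⁆ 𝔟.even
  odd : 𝔞.odd →ₗ[ℂ] 𝔟.odd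
  map_act : ∀ (X : 𝔞.even) (x : 𝔞.odd), odd ⁅X, x⁆ = ⁅even X, odd x⁆
  map_br : ∀ x y : 𝔞.odd, even (𝔞.br x y) = 𝔟.br (odd x) (odd y)

/-- Sub-superalgebras (graded subspaces closed under the superbracket). -/
structure Subsuperalgebra (𝔤 : LieSuperalgebra.{u}) where
  even : LieSubalgebra ℂ 𝔤.even
  odd : Submodule ℂ 𝔤.odd
  act_mem : ∀ X ∈ even, ∀ x ∈ odd, ⁅X, x⁆ ∈ odd
  br_mem : ∀ x ∈ odd, ∀ y ∈ odd, 𝔤.br x y ∈ even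

namespace Subsuperalgebra

variable {𝔤 : LieSuperalgebra.{u}}

instance (L : Subsuperalgebra 𝔤) : LieRingModule L.even L.odd where
  bracket X x := ⟨⁅(X : 𝔤.even), (x : 𝔤.odd)⁆, L.act_mem _ X.2 _ x.2⟩
  add_lie X Y x := Subtype.ext (add_lie (X : 𝔤.even) (Y : 𝔤.even) (x : 𝔤.odd))
  lie_add X x y := Subtype.ext (lie_add (X : 𝔤.even) (x : 𝔤.odd) (y : 𝔤.odd))
  leibniz_lie X Y x := Subtype.ext (leibniz_lie (X : 𝔤.even) (Y : 𝔤.even) (x : 𝔤.odd))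

instance (L : Subsuperalgebra 𝔤) : LieModule ℂ L.even L.odd where
  smul_lie c X x := Subtype.ext (smul_lie c (X : 𝔤.even) (x : 𝔤.odd))
  lie_smul c X x := Subtype.ext (lie_smul c (X : 𝔤.even) (x : 𝔤.odd))

/-- A sub-superalgebra, as a Lie superalgebra in its own right. -/
def toLieSuperalgebra (L : Subsuperalgebra 𝔤) : LieSuperalgebra.{u} where
  even := L.even
  odd := L.odd
  br := LinearMap.mk₂ ℂ (fun x y => ⟨𝔤.br x y, L.br_mem _ x.2 _ y.2⟩)
    (fun x x' y => Subtype.ext (by simp))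
    (fun c x y => Subtype.ext (by simp))
    (fun x y y' => Subtype.ext (by simp))
    (fun c x y => Subtype.ext (by simp))
  br_symm x y := Subtype.ext (𝔤.br_symm x y)
  lie_br X x y := Subtype.ext (𝔤.lie_br X x y)
  jacobi x y z := Subtype.ext (𝔤.jacobi x y z)

/-- The inclusion of one sub-superalgebra into another. -/
def inclusion {L M : Subsuperalgebra 𝔤} (h₀ : L.even ≤ M.even) (h₁ : L.odd ≤ M.odd) :
    Hom L.toLieSuperalgebra M.toLieSuperalgebra where
  even := LieSubalgebra.inclusion h₀
  odd := Submodule.inclusion h₁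
  map_act _ _ := rfl
  map_br _ _ := rfl

end Subsuperalgebra

/-! ## Relative cohomology `H^•(𝔞, 𝔞₀; ℂ)` with trivial coefficients

The complex is `C^n(𝔞, 𝔞₀; ℂ) = Hom_{𝔞₀}(Λ_s^n(𝔞 / 𝔞₀), ℂ)`.  The quotient `𝔞 / 𝔞₀ = 𝔞₁` is purely
odd, so that super-alternating `n`-linear forms on it are symmetric ones. -/

section Cohomology

variable (𝔞 : LieSuperalgebra.{u})

/-- `n`-linear forms on `𝔞 / 𝔞₀ = 𝔞₁`. -/
abbrev Form (n : ℕ) : Type u := MultilinearMap ℂ (fun _ : Fin n => 𝔞.odd) ℂ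

/-- The relative cochains: symmetric `𝔞₀`-invariant `n`-linear forms on `𝔞 / 𝔞₀ = 𝔞₁`. -/
def cochains (n : ℕ) : Submodule ℂ (𝔞.Form n) where
  carrier := {φ | (∀ (σ : Equiv.Perm (Fin n)) (x : Fin n → 𝔞.odd), φ (fun i => x (σ i)) = φ x) ∧
    ∀ (X : 𝔞.even) (x : Fin n → 𝔞.odd), ∑ i, φ (Function.update x i ⁅X, x i⁆) = 0}
  zero_mem' := by simp
  add_mem' := by
    rintro φ ψ ⟨h₁, h₂⟩ ⟨h₃, h₄⟩
    refine ⟨fun σ x => ?_, fun X x => ?_⟩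
    · simp [h₁ σ x, h₃ σ x]
    · simp [Finset.sum_add_distrib, h₂ X x, h₄ X x]
  smul_mem' := by
    rintro c φ ⟨h₁, h₂⟩
    refine ⟨fun σ x => ?_, fun X x => ?_⟩
    · simp [h₁ σ x]
    · simp [← Finset.mul_sum, h₂ X x]

/-- The value at odd `x₀, …, xₙ` of the differential of an `n`-cochain,
`(dφ)(x₀, …, xₙ) = ∑_{i<j} ± φ([xᵢ, xⱼ], x₀, …, x̂ᵢ, …, x̂ⱼ, …, xₙ)`, where `[xᵢ, xⱼ]` is taken modulo
`𝔞₀` (second component of the superbracket).  The sign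
`(-1) ^ (i + j + |xᵢ||xⱼ| + |xᵢ|(|x₀| + ⋯ + |xᵢ₋₁|) + |xⱼ|(|x₀| + ⋯ + |xⱼ₋₁|))` is `-1`, as all `xₖ`
are odd; the other terms of the differential involve the action on the trivial module and vanish.
A pair `i < j` of positions in `Fin (n + 2)` is written as `(i.castSucc, j.succ)` with `i ≤ j`. -/
def differential : {n : ℕ} → 𝔞.Form n → (Fin (n + 1) → 𝔞.odd) → ℂ
  | 0, _, _ => 0
  | n + 1, φ, x => -∑ i : Fin (n + 1), ∑ j ∈ Finset.Ici i,
      φ (Fin.cons (𝔞.bracket (0, x i.castSucc) (0, x j.succ)).2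
        (fun k : Fin n => x (j.succ.succAbove (i.succAbove k))))

theorem differential_add {n : ℕ} (φ ψ : 𝔞.Form n) (x : Fin (n + 1) → 𝔞.odd) :
    𝔞.differential (φ + ψ) x = 𝔞.differential φ x + 𝔞.differential ψ x := by
  cases n with
  | zero => simp [differential]
  | succ n => simp only [differential, _root_.add_apply, Finset.sum_add_distrib]; ring

theorem differential_smul {n : ℕ} (c : ℂ) (φ : 𝔞.Form n) (x : Fin (n + 1) → 𝔞.odd) :
    𝔞.differential (c • φ) x = c * 𝔞.differential φ x := by
  cases n with
  | zero => simp [differential]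
  | succ n =>
    simp only [differential, _root_.smul_apply, smul_eq_mul, ← Finset.mul_sum]; ring

/-- Cocycles of degree `n`. -/
def cocycles (n : ℕ) : Submodule ℂ (𝔞.Form n) where
  carrier := {φ | φ ∈ 𝔞.cochains n ∧ ∀ x, 𝔞.differential φ x = 0}
  zero_mem' := ⟨zero_mem _, fun x => by simpa using 𝔞.differential_smul 0 0 x⟩
  add_mem' h h' := ⟨add_mem h.1 h'.1, fun x => by rw [differential_add, h.2, h'.2, add_zero]⟩
  smul_mem' c _ h := ⟨Submodule.smul_mem _ c h.1, fun x => by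
    rw [differential_smul, h.2, mul_zero]⟩

/-- Coboundaries of degree `n`. -/
def coboundaries : (n : ℕ) → Submodule ℂ (𝔞.Form n)
  | 0 => ⊥
  | n + 1 =>
    { carrier := {φ | φ ∈ 𝔞.cochains (n + 1) ∧
        ∃ ψ ∈ 𝔞.cochains n, ∀ x, φ x = 𝔞.differential ψ x}
      zero_mem' := ⟨zero_mem _, 0, zero_mem _, fun x => by
        simpa using (𝔞.differential_smul 0 0 x).symm⟩
      add_mem' := by
        rintro _ _ ⟨h, ψ, hψ, e⟩ ⟨h', ψ', hψ', e'⟩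
        exact ⟨add_mem h h', ψ + ψ', add_mem hψ hψ', fun x => by
          rw [differential_add, ← e, ← e']; rfl⟩
      smul_mem' := by
        rintro c _ ⟨h, ψ, hψ, e⟩
        exact ⟨Submodule.smul_mem _ c h, c • ψ, Submodule.smul_mem _ c hψ, fun x => by
          rw [differential_smul, ← e]; rfl⟩ }

/-- The relative cohomology `H^n(𝔞, 𝔞₀; ℂ)`: cocycles modulo coboundaries. -/
abbrev H (n : ℕ) : Type u := ↥(𝔞.cocycles n) ⧸ (𝔞.coboundaries n).submoduleOf (𝔞.cocycles n)

/-- The class of a cocycle. -/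
def H.mk {n : ℕ} (φ : 𝔞.cocycles n) : 𝔞.H n :=
  ((𝔞.coboundaries n).submoduleOf (𝔞.cocycles n)).mkQ φ

/-- The product of a `p`-cochain and a `q`-cochain: the (super-)shuffle product, whose signs are
all `1` on odd arguments, written as a normalized sum over all permutations. -/
def cup {p q : ℕ} (φ : 𝔞.Form p) (ψ : 𝔞.Form q) (x : Fin (p + q) → 𝔞.odd) : ℂ :=
  ((p.factorial : ℂ) * (q.factorial : ℂ))⁻¹ * ∑ σ : Equiv.Perm (Fin (p + q)),
    φ (fun i => x (σ (Fin.castAdd q i))) * ψ (fun j => x (σ (Fin.natAdd p j)))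

/-- `c` is the product of the cohomology classes `a` and `b`. -/
def IsCup {p q : ℕ} (a : 𝔞.H p) (b : 𝔞.H q) (c : 𝔞.H (p + q)) : Prop :=
  ∃ (φ : 𝔞.cocycles p) (ψ : 𝔞.cocycles q) (χ : 𝔞.cocycles (p + q)),
    H.mk 𝔞 φ = a ∧ H.mk 𝔞 ψ = b ∧ H.mk 𝔞 χ = c ∧
      ∀ x, (χ : 𝔞.Form (p + q)) x = 𝔞.cup (φ : 𝔞.Form p) (ψ : 𝔞.Form q) x

variable {𝔞} {𝔟 : LieSuperalgebra.{u}}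

/-- Pullback of forms along a homomorphism. -/
def Hom.pullForm (θ : Hom 𝔞 𝔟) (n : ℕ) : 𝔟.Form n →ₗ[ℂ] 𝔞.Form n where
  toFun φ := φ.compLinearMap (fun _ => θ.odd)
  map_add' _ _ := rfl
  map_smul' _ _ := rfl

theorem Hom.pullForm_apply (θ : Hom 𝔞 𝔟) {n : ℕ} (φ : 𝔟.Form n) (x : Fin n → 𝔞.odd) :
    θ.pullForm n φ x = φ (fun i => θ.odd (x i)) := rfl

theorem Hom.pullForm_cochains (θ : Hom 𝔞 𝔟) {n : ℕ} {φ : 𝔟.Form n} (h : φ ∈ 𝔟.cochains n) :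
    θ.pullForm n φ ∈ 𝔞.cochains n := by
  refine ⟨fun σ x => h.1 σ (fun i => θ.odd (x i)), fun X x => ?_⟩
  rw [← h.2 (θ.even X) (fun i => θ.odd (x i))]
  refine Finset.sum_congr rfl fun i _ => ?_
  rw [Hom.pullForm_apply, ← θ.map_act]
  congr 1
  funext j
  by_cases hj : j = i
  · subst hj; simp
  · simp [Function.update_of_ne hj]

theorem Hom.differential_pullForm (θ : Hom 𝔞 𝔟) {n : ℕ} (φ : 𝔟.Form n)
    (x : Fin (n + 1) → 𝔞.odd) :
    𝔞.differential (θ.pullForm n φ) x = 𝔟.differential φ (fun i => θ.odd (x i)) := by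
  cases n with
  | zero => rfl
  | succ n =>
    simp only [differential, Hom.pullForm_apply]
    congr 1
    refine Finset.sum_congr rfl fun i _ => Finset.sum_congr rfl fun j _ => ?_
    congr 1
    funext k
    refine Fin.cases ?_ (fun k => ?_) k
    · simp [bracket]
    · simp

theorem Hom.pullForm_cocycles (θ : Hom 𝔞 𝔟) {n : ℕ} {φ : 𝔟.Form n} (h : φ ∈ 𝔟.cocycles n) :
    θ.pullForm n φ ∈ 𝔞.cocycles n :=
  ⟨θ.pullForm_cochains h.1, fun x => by rw [θ.differential_pullForm, h.2]⟩

theorem Hom.pullForm_coboundaries (θ : Hom 𝔞 𝔟) {n : ℕ} {φ : 𝔟.Form n}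
    (h : φ ∈ 𝔟.coboundaries n) : θ.pullForm n φ ∈ 𝔞.coboundaries n := by
  cases n with
  | zero =>
    have h' : φ = 0 := h
    subst h'
    exact (map_zero (θ.pullForm 0) : _)
  | succ n =>
    obtain ⟨h, ψ, hψ, e⟩ := h
    exact ⟨θ.pullForm_cochains h, θ.pullForm n ψ, θ.pullForm_cochains hψ, fun x => by
      rw [θ.differential_pullForm, θ.pullForm_apply, e]⟩

/-- The map `H^n(𝔟, 𝔟₀; ℂ) → H^n(𝔞, 𝔞₀; ℂ)` induced by a homomorphism `𝔞 → 𝔟`. -/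
def Hom.pullback (θ : Hom 𝔞 𝔟) (n : ℕ) : 𝔟.H n →ₗ[ℂ] 𝔞.H n :=
  Submodule.mapQ _ _
    ((θ.pullForm n).restrict (p := 𝔟.cocycles n) (q := 𝔞.cocycles n)
      (fun _ h => θ.pullForm_cocycles h))
    (fun _ h => θ.pullForm_coboundaries h)

end Cohomology

/-- The homogeneous component `S^n(V^*)` of the symmetric algebra `S^•(V^*)`. -/
def symPower (V : Type u) [AddCommGroup V] [Module ℂ V] (n : ℕ) :
    Submodule ℂ (SymmetricAlgebra ℂ (Module.Dual ℂ V)) :=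
  (LinearMap.range (SymmetricAlgebra.ι ℂ (Module.Dual ℂ V))) ^ n

end LieSuperalgebra

/-! ## Linear algebraic groups over `ℂ`, as Zariski closed subgroups of `GL_N(ℂ)` -/

namespace LinAlgGroup

variable {N : ℕ}

/-- Zariski closed in `GL_N(ℂ)`. -/
def IsAlgebraic (G : Subgroup (Matrix.GeneralLinearGroup (Fin N) ℂ)) : Prop :=
  ∃ S : Set (MvPolynomial (Fin N × Fin N) ℂ), ∀ g : Matrix.GeneralLinearGroup (Fin N) ℂ,
    g ∈ G ↔ ∀ p ∈ S, MvPolynomial.eval (fun ij => (g : Matrix (Fin N) (Fin N) ℂ) ij.1 ij.2) p = 0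

/-- Zariski connected: there is no proper closed subgroup of finite index. -/
def IsConnected (G : Subgroup (Matrix.GeneralLinearGroup (Fin N) ℂ)) : Prop :=
  ∀ K : Subgroup (Matrix.GeneralLinearGroup (Fin N) ℂ), IsAlgebraic K → K ≤ G →
    (K.subgroupOf G).FiniteIndex → K = G

/-- Reductive: the only closed normal subgroup that consists of unipotent matrices is trivial
(closed unipotent groups are connected in characteristic zero). -/
def IsReductive (G : Subgroup (Matrix.GeneralLinearGroup (Fin N) ℂ)) : Prop :=
  ∀ U : Subgroup (Matrix.GeneralLinearGroup (Fin N) ℂ), IsAlgebraic U → U ≤ G →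
    (∀ g ∈ G, ∀ v ∈ U, g * v * g⁻¹ ∈ U) →
    (∀ v ∈ U, IsNilpotent ((v : Matrix (Fin N) (Fin N) ℂ) - 1)) → U = ⊥

/-- An algebraic torus: the image of `(ℂˣ)^r` under a homomorphism of algebraic groups into
`GL_N(ℂ)`, i.e. in a suitable basis it acts diagonally through Laurent monomials. -/
def IsTorus (T : Subgroup (Matrix.GeneralLinearGroup (Fin N) ℂ)) : Prop :=
  ∃ (r : ℕ) (P : Matrix.GeneralLinearGroup (Fin N) ℂ) (a : Fin N → Fin r → ℤ),
    ∀ g : Matrix.GeneralLinearGroup (Fin N) ℂ, g ∈ T ↔ ∃ s : Fin r → ℂˣ,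
      (g : Matrix (Fin N) (Fin N) ℂ) = (P : Matrix (Fin N) (Fin N) ℂ) *
        Matrix.diagonal (fun k => ∏ j, (s j : ℂ) ^ (a k j)) *
        ((P⁻¹ : Matrix.GeneralLinearGroup (Fin N) ℂ) : Matrix (Fin N) (Fin N) ℂ)

/-- `M` lies in the Lie algebra of `G`, i.e. `exp (s M) ∈ G` for all `s ∈ ℂ`. -/
def InLie (G : Subgroup (Matrix.GeneralLinearGroup (Fin N) ℂ)) (M : Matrix (Fin N) (Fin N) ℂ) :
    Prop :=
  ∀ s : ℂ, ∃ g ∈ G, (g : Matrix (Fin N) (Fin N) ℂ) = NormedSpace.exp (s • M)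

end LinAlgGroup

/-! ## Classical Lie superalgebras, detecting subalgebras and the parabolic subalgebras -/

/-- The data which make the finite-dimensional Lie superalgebra `𝔤` classical: a connected reductive
algebraic group `G₀` with `Lie G₀ = 𝔤₀` which acts on `𝔤` by automorphisms, through the adjoint
action on `𝔤₀` and through a rational representation on `𝔤₁` whose differential is the adjoint
action of `𝔤₀` on `𝔤₁`. -/
structure ClassicalStructure (𝔤 : LieSuperalgebra.{u}) where
  finEven : FiniteDimensional ℂ 𝔤.even
  finOdd : FiniteDimensional ℂ 𝔤.odd
  N : ℕ
  /-- the group `G₀` -/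
  G : Subgroup (Matrix.GeneralLinearGroup (Fin N) ℂ)
  algebraic : LinAlgGroup.IsAlgebraic G
  connected : LinAlgGroup.IsConnected G
  reductive : LinAlgGroup.IsReductive G
  /-- the identification of `𝔤₀` with `Lie G₀` -/
  ρ : 𝔤.even →ₗ[ℂ] Matrix (Fin N) (Fin N) ℂ
  ρ_lie : ∀ X Y, ρ ⁅X, Y⁆ = ρ X * ρ Y - ρ Y * ρ X
  ρ_injective : Function.Injective ρ
  ρ_range : ∀ M, (∃ X, ρ X = M) ↔ LinAlgGroup.InLie G M
  /-- the adjoint action of `G₀` on `𝔤₀` -/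
  Ad : Representation ℂ G 𝔤.even
  ρ_Ad : ∀ (g : G) (X : 𝔤.even),
    ρ (Ad g X) = ((g : Matrix.GeneralLinearGroup (Fin N) ℂ) : Matrix (Fin N) (Fin N) ℂ) * ρ X *
      (((g : Matrix.GeneralLinearGroup (Fin N) ℂ)⁻¹ : Matrix.GeneralLinearGroup (Fin N) ℂ) :
        Matrix (Fin N) (Fin N) ℂ)
  /-- the action of `G₀` on `𝔤₁` -/
  r : Representation ℂ G 𝔤.odd
  r_rational : ∀ (v : 𝔤.odd) (l : Module.Dual ℂ 𝔤.odd),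
    ∃ (p : MvPolynomial (Fin N × Fin N) ℂ) (k : ℕ), ∀ g : G,
      ((g : Matrix.GeneralLinearGroup (Fin N) ℂ) : Matrix (Fin N) (Fin N) ℂ).det ^ k * l (r g v) =
        MvPolynomial.eval (fun ij =>
          ((g : Matrix.GeneralLinearGroup (Fin N) ℂ) : Matrix (Fin N) (Fin N) ℂ) ij.1 ij.2) p
  r_differential : ∀ (X : 𝔤.even) (c : ℂ → G),
    (∀ s, ((c s : Matrix.GeneralLinearGroup (Fin N) ℂ) : Matrix (Fin N) (Fin N) ℂ) =
      NormedSpace.exp (s • ρ X)) →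
    ∀ (v : 𝔤.odd) (l : Module.Dual ℂ 𝔤.odd), HasDerivAt (fun s => l (r (c s) v)) (l ⁅X, v⁆) 0
  r_act : ∀ (g : G) (X : 𝔤.even) (x : 𝔤.odd), r g ⁅X, x⁆ = ⁅Ad g X, r g x⁆
  Ad_br : ∀ (g : G) (x y : 𝔤.odd), Ad g (𝔤.br x y) = 𝔤.br (r g x) (r g y)

namespace ClassicalStructure

open LieSuperalgebra

variable {𝔤 : LieSuperalgebra.{u}} (C : ClassicalStructure 𝔤)

theorem Ad_lie (g : C.G) (X Y : 𝔤.even) : C.Ad g ⁅X, Y⁆ = ⁅C.Ad g X, C.Ad g Y⁆ := by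
  apply C.ρ_injective
  have h : ∀ A B : Matrix (Fin C.N) (Fin C.N) ℂ,
      ((g : Matrix.GeneralLinearGroup (Fin C.N) ℂ) : Matrix (Fin C.N) (Fin C.N) ℂ) * A *
        (((g : Matrix.GeneralLinearGroup (Fin C.N) ℂ)⁻¹ :
          Matrix.GeneralLinearGroup (Fin C.N) ℂ) : Matrix (Fin C.N) (Fin C.N) ℂ) *
      (((g : Matrix.GeneralLinearGroup (Fin C.N) ℂ) : Matrix (Fin C.N) (Fin C.N) ℂ) * B *
        (((g : Matrix.GeneralLinearGroup (Fin C.N) ℂ)⁻¹ :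
          Matrix.GeneralLinearGroup (Fin C.N) ℂ) : Matrix (Fin C.N) (Fin C.N) ℂ)) =
      ((g : Matrix.GeneralLinearGroup (Fin C.N) ℂ) : Matrix (Fin C.N) (Fin C.N) ℂ) * (A * B) *
        (((g : Matrix.GeneralLinearGroup (Fin C.N) ℂ)⁻¹ :
          Matrix.GeneralLinearGroup (Fin C.N) ℂ) : Matrix (Fin C.N) (Fin C.N) ℂ) := by
    intro A B
    have := Units.inv_mul (g : Matrix.GeneralLinearGroup (Fin C.N) ℂ)
    simp only [mul_assoc]
    rw [← mul_assoc _ _ (B * _), this, one_mul]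
  rw [C.ρ_Ad, C.ρ_lie, C.ρ_lie, C.ρ_Ad, C.ρ_Ad, h, h, mul_sub, sub_mul]

/-- The stabilizer `H` of `x₀ ∈ 𝔤₁` in `G₀`. -/
def stab (x₀ : 𝔤.odd) : Set C.G := {g | C.r g x₀ = x₀}

/-- `𝔣₁ = 𝔤₁^H`, the vectors of `𝔤₁` fixed by the stabilizer `H` of `x₀`. -/
def detectingOdd (x₀ : 𝔤.odd) : Submodule ℂ 𝔤.odd where
  carrier := {z | ∀ g ∈ C.stab x₀, C.r g z = z}
  zero_mem' := fun _ _ => map_zero _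
  add_mem' h h' := fun g hg => by rw [map_add, h g hg, h' g hg]
  smul_mem' c _ h := fun g hg => by rw [map_smul, h g hg]

/-- `𝔣₀ = [𝔣₁, 𝔣₁]`, as a subspace. -/
def detectingEven (x₀ : 𝔤.odd) : Submodule ℂ 𝔤.even :=
  Submodule.span ℂ {X | ∃ x ∈ C.detectingOdd x₀, ∃ y ∈ C.detectingOdd x₀, 𝔤.br x y = X}

theorem detecting_act_mem (x₀ : 𝔤.odd) (X : 𝔤.even) (hX : X ∈ C.detectingEven x₀) (z : 𝔤.odd)
    (hz : z ∈ C.detectingOdd x₀) : ⁅X, z⁆ ∈ C.detectingOdd x₀ := by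
  refine Submodule.span_induction (p := fun X _ => ⁅X, z⁆ ∈ C.detectingOdd x₀)
    ?_ ?_ ?_ ?_ hX
  · rintro _ ⟨x, hx, y, hy, rfl⟩ g hg
    rw [C.r_act, C.Ad_br, hx g hg, hy g hg, hz g hg]
  · rw [zero_lie]; exact zero_mem _
  · intro X Y _ _ h h'; rw [add_lie]; exact add_mem h h'
  · intro c X _ h; rw [smul_lie]; exact Submodule.smul_mem _ c h

/-- The detecting subalgebra `𝔣 = 𝔣₀ ⊕ 𝔣₁` attached to `x₀`, with `𝔣₁ = 𝔤₁^H` and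
`𝔣₀ = [𝔣₁, 𝔣₁]`. -/
def detecting (x₀ : 𝔤.odd) : Subsuperalgebra 𝔤 where
  even :=
    { C.detectingEven x₀ with
      lie_mem' := by
        intro X Y hX hY
        refine Submodule.span_induction (p := fun Y _ => ⁅X, Y⁆ ∈ C.detectingEven x₀)
          ?_ ?_ ?_ ?_ hY
        · rintro _ ⟨x, hx, y, hy, rfl⟩
          rw [𝔤.lie_br]
          exact add_mem
            (Submodule.subset_span ⟨_, C.detecting_act_mem x₀ X hX x hx, y, hy, rfl⟩)
            (Submodule.subset_span ⟨x, hx, _, C.detecting_act_mem x₀ X hX y hy, rfl⟩)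
        · rw [lie_zero]; exact zero_mem _
        · intro Y Y' _ _ h h'; rw [lie_add]; exact add_mem h h'
        · intro c Y _ h; rw [lie_smul]; exact Submodule.smul_mem _ c h }
  odd := C.detectingOdd x₀
  act_mem := C.detecting_act_mem x₀
  br_mem x hx y hy := Submodule.subset_span ⟨x, hx, y, hy, rfl⟩

/-- A maximal torus `T₀` of `G₀`, with its Lie algebra `𝔱₀ ⊆ 𝔤₀`. -/
structure MaximalTorus where
  /-- the group `T₀` -/
  T : Subgroup (Matrix.GeneralLinearGroup (Fin C.N) ℂ)
  le : T ≤ C.G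
  isTorus : LinAlgGroup.IsTorus T
  maximal : ∀ T' : Subgroup (Matrix.GeneralLinearGroup (Fin C.N) ℂ),
    LinAlgGroup.IsTorus T' → T ≤ T' → T' ≤ C.G → T' = T
  /-- the Lie algebra `𝔱₀` -/
  t : LieSubalgebra ℂ 𝔤.even
  mem_t : ∀ X : 𝔤.even, X ∈ t ↔ LinAlgGroup.InLie T (C.ρ X)

variable {C} (T : C.MaximalTorus)

/-- The `α`-weight space of `𝔤₀` for `α ∈ 𝔱₀^*`. -/
def MaximalTorus.evenWeight (α : Module.Dual ℂ T.t) : Submodule ℂ 𝔤.even where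
  carrier := {Y | ∀ h : T.t, ⁅(h : 𝔤.even), Y⁆ = α h • Y}
  zero_mem' := fun h => by simp
  add_mem' hY hZ := fun h => by rw [lie_add, hY, hZ, smul_add]
  smul_mem' c _ hY := fun h => by rw [lie_smul, hY, smul_comm]

/-- The `α`-weight space of `𝔤₁` for `α ∈ 𝔱₀^*`. -/
def MaximalTorus.oddWeight (α : Module.Dual ℂ T.t) : Submodule ℂ 𝔤.odd where
  carrier := {x | ∀ h : T.t, ⁅(h : 𝔤.even), x⁆ = α h • x}
  zero_mem' := fun h => by simp
  add_mem' hY hZ := fun h => by rw [lie_add, hY, hZ, smul_add]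
  smul_mem' c _ hY := fun h => by rw [lie_smul, hY, smul_comm]

/-- A linear functional `𝓗` on the real span of the roots (extended to a real linear functional on
`𝔱₀^*`) that defines the parabolic subalgebra adapted to the detecting subalgebra `𝔣` of `x₀`:
no root of `𝔤₀` lies on the hyperplane `ker 𝓗`; `𝔣₁` is the sum of the weight spaces of `𝔤₁` whose
weight lies on `ker 𝓗` (this includes the weight `0`); `𝔣₀ ⊆ 𝔱₀`; and `𝔣₁` is `T₀`-stable. -/
structure MaximalTorus.ParabolicFunctional (x₀ : 𝔤.odd) where
  𝓗 : Module.Dual ℂ T.t →ₗ[ℝ] ℝ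
  regular : ∀ α : Module.Dual ℂ T.t, α ≠ 0 → T.evenWeight α ≠ ⊥ → 𝓗 α ≠ 0
  f_odd : C.detectingOdd x₀ = ⨆ α ∈ {α : Module.Dual ℂ T.t | 𝓗 α = 0}, T.oddWeight α
  f_even : C.detectingEven x₀ ≤ T.t.toSubmodule
  f_stable : ∀ g : C.G, (g : Matrix.GeneralLinearGroup (Fin C.N) ℂ) ∈ T.T →
    ∀ x ∈ C.detectingOdd x₀, C.r g x ∈ C.detectingOdd x₀

namespace MaximalTorus.ParabolicFunctional

variable {T} {x₀ : 𝔤.odd} (P : T.ParabolicFunctional x₀)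

/-- `𝔲₀`: the sum of the root spaces of `𝔤₀` below the hyperplane. -/
def uEven : Submodule ℂ 𝔤.even := ⨆ α ∈ {α : Module.Dual ℂ T.t | P.𝓗 α < 0}, T.evenWeight α

/-- `𝔲₁`: the sum of the root spaces of `𝔤₁` below the hyperplane. -/
def uOdd : Submodule ℂ 𝔤.odd := ⨆ α ∈ {α : Module.Dual ℂ T.t | P.𝓗 α < 0}, T.oddWeight α

theorem evenWeight_le_uEven {α : Module.Dual ℂ T.t} (h : P.𝓗 α < 0) :
    T.evenWeight α ≤ P.uEven :=
  le_iSup₂_of_le (f := fun α (_ : α ∈ {α : Module.Dual ℂ T.t | P.𝓗 α < 0}) => T.evenWeight α)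
    α h le_rfl

theorem oddWeight_le_uOdd {α : Module.Dual ℂ T.t} (h : P.𝓗 α < 0) : T.oddWeight α ≤ P.uOdd :=
  le_iSup₂_of_le (f := fun α (_ : α ∈ {α : Module.Dual ℂ T.t | P.𝓗 α < 0}) => T.oddWeight α)
    α h le_rfl

theorem lie_evenWeight {α β : Module.Dual ℂ T.t} {X Y : 𝔤.even} (hX : X ∈ T.evenWeight α)
    (hY : Y ∈ T.evenWeight β) : ⁅X, Y⁆ ∈ T.evenWeight (α + β) := fun h => by
  rw [leibniz_lie, hX h, hY h, smul_lie, lie_smul, LinearMap.add_apply, add_smul]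

theorem lie_oddWeight {α β : Module.Dual ℂ T.t} {X : 𝔤.even} {x : 𝔤.odd}
    (hX : X ∈ T.evenWeight α) (hx : x ∈ T.oddWeight β) : ⁅X, x⁆ ∈ T.oddWeight (α + β) :=
  fun h => by
    rw [leibniz_lie, hX h, hx h, smul_lie, lie_smul, LinearMap.add_apply, add_smul]

theorem br_oddWeight {α β : Module.Dual ℂ T.t} {x y : 𝔤.odd} (hx : x ∈ T.oddWeight α)
    (hy : y ∈ T.oddWeight β) : 𝔤.br x y ∈ T.evenWeight (α + β) := fun h => by
  rw [𝔤.lie_br, hx h, hy h, map_smul, map_smul, LinearMap.smul_apply, LinearMap.add_apply,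
    add_smul]

theorem t_lie_evenWeight {α : Module.Dual ℂ T.t} {X Y : 𝔤.even} (hX : X ∈ T.t)
    (hY : Y ∈ T.evenWeight α) : ⁅X, Y⁆ ∈ T.evenWeight α := by
  rw [hY ⟨X, hX⟩]; exact Submodule.smul_mem _ _ hY

theorem t_lie_oddWeight {α : Module.Dual ℂ T.t} {X : 𝔤.even} {x : 𝔤.odd} (hX : X ∈ T.t)
    (hx : x ∈ T.oddWeight α) : ⁅X, x⁆ ∈ T.oddWeight α := by
  rw [hx ⟨X, hX⟩]; exact Submodule.smul_mem _ _ hx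

/-- The bracket `𝔤₀ × 𝔤₀ → 𝔤₀` as a bilinear map. -/
def lieEven (𝔤 : LieSuperalgebra.{u}) : 𝔤.even →ₗ[ℂ] 𝔤.even →ₗ[ℂ] 𝔤.even :=
  LinearMap.mk₂ ℂ (fun X Y => ⁅X, Y⁆) add_lie smul_lie lie_add (fun c X Y => lie_smul c X Y)

/-- The bracket `𝔤₀ × 𝔤₁ → 𝔤₁` as a bilinear map. -/
def lieOdd (𝔤 : LieSuperalgebra.{u}) : 𝔤.even →ₗ[ℂ] 𝔤.odd →ₗ[ℂ] 𝔤.odd :=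
  LinearMap.mk₂ ℂ (fun X x => ⁅X, x⁆) add_lie smul_lie lie_add (fun c X x => lie_smul c X x)

theorem t_lie_uEven {X Y : 𝔤.even} (hX : X ∈ T.t) (hY : Y ∈ P.uEven) : ⁅X, Y⁆ ∈ P.uEven := by
  have h : P.uEven ≤ P.uEven.comap (lieEven 𝔤 X) := iSup₂_le fun α hα Y hY =>
    P.evenWeight_le_uEven hα (t_lie_evenWeight hX hY)
  exact h hY

theorem uEven_lie_uEven {X Y : 𝔤.even} (hX : X ∈ P.uEven) (hY : Y ∈ P.uEven) :
    ⁅X, Y⁆ ∈ P.uEven := by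
  have h : ∀ α, P.𝓗 α < 0 → ∀ X ∈ T.evenWeight α, P.uEven ≤ P.uEven.comap (lieEven 𝔤 X) :=
    fun α hα X hX => iSup₂_le fun β hβ Y hY => by
      refine P.evenWeight_le_uEven (α := α + β) ?_ (lie_evenWeight hX hY)
      rw [map_add]; exact add_neg hα hβ
  have h' : P.uEven ≤ P.uEven.comap ((lieEven 𝔤).flip Y) := iSup₂_le fun α hα X hX => h α hα X hX hY
  exact h' hX

/-- The even part of `𝔟`: the subalgebra `𝔟₀ = 𝔱₀ ⊕ 𝔲₀` of `𝔤₀`. -/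
def bEven : LieSubalgebra ℂ 𝔤.even :=
  { T.t.toSubmodule ⊔ P.uEven with
    lie_mem' := by
      intro X Y hX hY
      obtain ⟨X₁, hX₁, X₂, hX₂, rfl⟩ := Submodule.mem_sup.mp hX
      obtain ⟨Y₁, hY₁, Y₂, hY₂, rfl⟩ := Submodule.mem_sup.mp hY
      rw [add_lie, lie_add, lie_add]
      refine Submodule.add_mem _ (Submodule.add_mem _ ?_ ?_) (Submodule.add_mem _ ?_ ?_)
      · exact Submodule.mem_sup_left (T.t.lie_mem hX₁ hY₁)
      · exact Submodule.mem_sup_right (P.t_lie_uEven hX₁ hY₂)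
      · rw [← lie_skew]
        exact Submodule.neg_mem _ (Submodule.mem_sup_right (P.t_lie_uEven hY₁ hX₂))
      · exact Submodule.mem_sup_right (P.uEven_lie_uEven hX₂ hY₂) }

/-- The odd part `𝔟₁ = 𝔣₁ ⊕ 𝔲₁` of `𝔟`. -/
def bOdd : Submodule ℂ 𝔤.odd := C.detectingOdd x₀ ⊔ P.uOdd

theorem oddWeight_le_bOdd {α : Module.Dual ℂ T.t} (h : P.𝓗 α ≤ 0) : T.oddWeight α ≤ P.bOdd := by
  rcases h.lt_or_eq with h | h
  · exact (P.oddWeight_le_uOdd h).trans le_sup_right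
  · refine le_trans ?_ le_sup_left
    rw [P.f_odd]
    exact le_iSup₂_of_le
      (f := fun α (_ : α ∈ {α : Module.Dual ℂ T.t | P.𝓗 α = 0}) => T.oddWeight α) α h le_rfl

theorem bOdd_le {S : Submodule ℂ 𝔤.odd}
    (h : ∀ α : Module.Dual ℂ T.t, P.𝓗 α ≤ 0 → ∀ x ∈ T.oddWeight α, x ∈ S) : P.bOdd ≤ S := by
  refine sup_le ?_ (iSup₂_le fun α hα x hx => h α (le_of_lt hα) x hx)
  rw [P.f_odd]
  exact iSup₂_le fun α hα x hx => h α (le_of_eq hα) x hx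

theorem b_act_mem {X : 𝔤.even} (hX : X ∈ P.bEven) {x : 𝔤.odd} (hx : x ∈ P.bOdd) :
    ⁅X, x⁆ ∈ P.bOdd := by
  obtain ⟨X₁, hX₁, X₂, hX₂, rfl⟩ := Submodule.mem_sup.mp hX
  rw [add_lie]
  refine add_mem ?_ ?_
  · have h : P.bOdd ≤ P.bOdd.comap (lieOdd 𝔤 X₁) := P.bOdd_le fun α hα x hx =>
      P.oddWeight_le_bOdd hα (t_lie_oddWeight hX₁ hx)
    exact h hx
  · have h : ∀ α, P.𝓗 α < 0 → ∀ X ∈ T.evenWeight α, P.bOdd ≤ P.bOdd.comap (lieOdd 𝔤 X) :=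
      fun α hα X hX => P.bOdd_le fun β hβ y hy => by
        refine P.oddWeight_le_bOdd (α := α + β) ?_ (lie_oddWeight hX hy)
        rw [map_add]; exact (add_neg_of_neg_of_nonpos hα hβ).le
    have h' : P.uEven ≤ P.bOdd.comap ((lieOdd 𝔤).flip x) :=
      iSup₂_le fun α hα X hX => h α hα X hX hx
    exact h' hX₂

theorem br_mem_bEven_of_lt {α β : Module.Dual ℂ T.t} (h : P.𝓗 α + P.𝓗 β < 0) {x y : 𝔤.odd}
    (hx : x ∈ T.oddWeight α) (hy : y ∈ T.oddWeight β) : 𝔤.br x y ∈ P.bEven := by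
  refine Submodule.mem_sup_right (P.evenWeight_le_uEven (α := α + β) ?_ (br_oddWeight hx hy))
  rw [map_add]; exact h

theorem br_uOdd_mem {x y : 𝔤.odd} (hx : x ∈ P.uOdd) (hy : y ∈ P.bOdd) : 𝔤.br x y ∈ P.bEven := by
  have h : ∀ α, P.𝓗 α < 0 → ∀ x ∈ T.oddWeight α,
      P.bOdd ≤ P.bEven.toSubmodule.comap (𝔤.br x) :=
    fun α hα x hx => P.bOdd_le fun β hβ y hy =>
      P.br_mem_bEven_of_lt (add_neg_of_neg_of_nonpos hα hβ) hx hy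
  have h' : P.uOdd ≤ P.bEven.toSubmodule.comap (𝔤.br.flip y) :=
    iSup₂_le fun α hα x hx => h α hα x hx hy
  exact h' hx

/-- The parabolic subalgebra `𝔟 = 𝔱 ⊕ 𝔲`, where `𝔱 = 𝔱₀ ⊕ 𝔣₁` and `𝔲 = 𝔲₀ ⊕ 𝔲₁`. -/
def parabolic : Subsuperalgebra 𝔤 where
  even := P.bEven
  odd := P.bOdd
  act_mem _ hX _ hx := P.b_act_mem hX hx
  br_mem x hx y hy := by
    obtain ⟨x₁, hx₁, x₂, hx₂, rfl⟩ := Submodule.mem_sup.mp hx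
    rw [map_add, LinearMap.add_apply]
    refine P.bEven.add_mem ?_ (P.br_uOdd_mem hx₂ hy)
    obtain ⟨y₁, hy₁, y₂, hy₂, rfl⟩ := Submodule.mem_sup.mp hy
    rw [map_add]
    refine P.bEven.add_mem ?_ ?_
    · exact Submodule.mem_sup_left
        (P.f_even (Submodule.subset_span ⟨x₁, hx₁, y₁, hy₁, rfl⟩))
    · rw [𝔤.br_symm]
      exact P.br_uOdd_mem hy₂ (Submodule.mem_sup_left hx₁)

/-- The inclusion `𝔣 → 𝔟`. -/
def detectingInclusion :
    Hom (C.detecting x₀).toLieSuperalgebra P.parabolic.toLieSuperalgebra :=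
  Subsuperalgebra.inclusion (L := C.detecting x₀) (M := P.parabolic)
    (fun _ hX => Submodule.mem_sup_left (P.f_even hX))
    (fun _ hx => Submodule.mem_sup_left hx)

/-- The restriction map `H^n(𝔟, 𝔟₀; ℂ) → H^n(𝔣, 𝔣₀; ℂ)`. -/
def res (n : ℕ) :
    P.parabolic.toLieSuperalgebra.H n →ₗ[ℂ] (C.detecting x₀).toLieSuperalgebra.H n :=
  P.detectingInclusion.pullback n

theorem Ad_detectingEven (P : T.ParabolicFunctional x₀) {g : C.G}
    (hg : (g : Matrix.GeneralLinearGroup (Fin C.N) ℂ) ∈ T.T) {X : 𝔤.even}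
    (hX : X ∈ C.detectingEven x₀) : C.Ad g X ∈ C.detectingEven x₀ := by
  have h : C.detectingEven x₀ ≤ (C.detectingEven x₀).comap (C.Ad g) := by
    refine Submodule.span_le.mpr ?_
    rintro _ ⟨x, hx, y, hy, rfl⟩
    change C.Ad g (𝔤.br x y) ∈ C.detectingEven x₀
    rw [C.Ad_br]
    exact Submodule.subset_span ⟨_, P.f_stable g hg x hx, _, P.f_stable g hg y hy, rfl⟩
  exact h hX

/-- The action of an element of `T₀` on `𝔣`. -/
def torusHom (g : C.G) (hg : (g : Matrix.GeneralLinearGroup (Fin C.N) ℂ) ∈ T.T) :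
    Hom (C.detecting x₀).toLieSuperalgebra (C.detecting x₀).toLieSuperalgebra where
  even :=
    { toFun := fun X => ⟨C.Ad g X.1, P.Ad_detectingEven hg X.2⟩
      map_add' := fun X Y => Subtype.ext (map_add (C.Ad g) X.1 Y.1)
      map_smul' := fun c X => Subtype.ext (map_smul (C.Ad g) c X.1)
      map_lie' := fun {X Y} => Subtype.ext (C.Ad_lie g X.1 Y.1) }
  odd :=
    { toFun := fun x => ⟨C.r g x.1, P.f_stable g hg x.1 x.2⟩
      map_add' := fun x y => Subtype.ext (map_add (C.r g) x.1 y.1)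
      map_smul' := fun c x => Subtype.ext (map_smul (C.r g) c x.1) }
  map_act X x := Subtype.ext (C.r_act g X.1 x.1)
  map_br x y := Subtype.ext (C.Ad_br g x.1 y.1)

/-- The invariants `H^n(𝔣, 𝔣₀; ℂ)^{T₀}`. -/
def invariants (n : ℕ) : Submodule ℂ ((C.detecting x₀).toLieSuperalgebra.H n) :=
  ⨅ (g : C.G) (hg : (g : Matrix.GeneralLinearGroup (Fin C.N) ℂ) ∈ T.T),
    LinearMap.eqLocus ((P.torusHom g hg).pullback n) LinearMap.id

end MaximalTorus.ParabolicFunctional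

end ClassicalStructure

end

/-! The bracket of two odd elements is even, so it vanishes modulo the even part: the differential
of the relative complex is zero (`differential_eq_zero`), and cohomology is just the space of
invariant symmetric forms on the odd part.

For (a) it remains to see that `𝔣₀` acts trivially on `𝔣₁` (`br_lie_weight`,
`lie_detecting_eq_zero`). All weights of `𝔣₁` lie on `ker 𝓗`, where `𝔤₀` has no roots, so two weight
vectors of `𝔣₁` have bracket zero unless their weights are opposite; the Jacobi identity does the
rest. Every symmetric form is then a cocycle, and symmetric forms are identified with `S^n(𝔣₁^*)` by
sending a form to its symmetric tensor, with polarization as left inverse (`formToSym_cupForm`,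
`polarize_formToSym`).

For (b), a `𝔱₀`-invariant form can be nonzero on weight vectors only if their weights sum to zero.
On `𝔟₁` all weights have `𝓗 ≤ 0`, so a single argument from `𝔲₁` forces the value zero
(`eq_zero_of_weight_neg`); hence restriction to `𝔣₁` is injective. Conversely, a form on `𝔣₁`
extended by zero along `𝔲₁` is killed by `𝔲₀`, because `𝔲₀` maps `𝔟₁` into `𝔲₁`; so the only
remaining condition is `𝔱₀`-invariance (`exists_extension`). This is the same as `T₀`-invariance,
because one-parameter subgroups act on weight vectors by exponentials (`r_curve_apply`) and every
element of `T₀` lies on one (`exists_curve_through`). -/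

noncomputable section

/-! ### Vanishing of the differential, and the product on forms. -/

namespace LieSuperalgebra

variable {𝔞 : LieSuperalgebra.{u}}

theorem differential_eq_zero {n : ℕ} (φ : 𝔞.Form n) (x : Fin (n + 1) → 𝔞.odd) :
    𝔞.differential φ x = 0 := by
  cases n with
  | zero => rfl
  | succ n =>
    rw [differential, neg_eq_zero]
    refine Finset.sum_eq_zero fun i _ => Finset.sum_eq_zero fun j _ => ?_
    exact φ.map_coord_zero 0 (by simp [bracket])

theorem mem_cocycles_iff {n : ℕ} {φ : 𝔞.Form n} : φ ∈ 𝔞.cocycles n ↔ φ ∈ 𝔞.cochains n :=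
  ⟨fun h => h.1, fun h => ⟨h, differential_eq_zero φ⟩⟩

theorem coboundaries_eq_bot (n : ℕ) : 𝔞.coboundaries n = ⊥ := by
  cases n with
  | zero => rfl
  | succ n =>
    refine (Submodule.eq_bot_iff _).2 ?_
    rintro φ ⟨-, ψ, -, h⟩
    ext x
    rw [h, differential_eq_zero]
    rfl

theorem H.mk_bijective (n : ℕ) :
    Function.Bijective (fun φ : 𝔞.cocycles n => H.mk 𝔞 φ) := by
  refine ⟨fun φ ψ h => ?_, Submodule.mkQ_surjective _⟩
  have h' := (Submodule.Quotient.eq _).1 h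
  rw [coboundaries_eq_bot] at h'
  exact Subtype.ext (sub_eq_zero.1 ((Submodule.mem_bot ℂ).1 h'))

/-- The projection of the cocycles onto the cohomology, which is an isomorphism as the
differential vanishes. -/
def H.mkEquiv (𝔞 : LieSuperalgebra.{u}) (n : ℕ) : 𝔞.cocycles n ≃ₗ[ℂ] 𝔞.H n :=
  LinearEquiv.ofBijective ((𝔞.coboundaries n).submoduleOf (𝔞.cocycles n)).mkQ (H.mk_bijective n)

theorem Hom.pullback_mk {𝔟 : LieSuperalgebra.{u}} (θ : Hom 𝔞 𝔟) {n : ℕ} (φ : 𝔟.cocycles n) :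
    θ.pullback n (H.mk 𝔟 φ) = H.mk 𝔞 ⟨θ.pullForm n φ, θ.pullForm_cocycles φ.2⟩ := rfl

/-- Pulling back forms commutes with the shuffle product on the nose, so representatives can be
pulled back one by one. -/
theorem Hom.pullback_isCup {𝔟 : LieSuperalgebra.{u}} (θ : Hom 𝔞 𝔟) {p q : ℕ} {a : 𝔟.H p}
    {b : 𝔟.H q} {c : 𝔟.H (p + q)} (h : 𝔟.IsCup a b c) :
    𝔞.IsCup (θ.pullback p a) (θ.pullback q b) (θ.pullback (p + q) c) := by
  obtain ⟨φ, ψ, χ, rfl, rfl, rfl, h⟩ := h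
  exact ⟨_, _, _, (θ.pullback_mk φ).symm, (θ.pullback_mk ψ).symm, (θ.pullback_mk χ).symm,
    fun x => h (fun i => θ.odd (x i))⟩

/-- The product `cup φ ψ` as a multilinear form. -/
def cupForm {p q : ℕ} (φ : 𝔞.Form p) (ψ : 𝔞.Form q) : 𝔞.Form (p + q) :=
  ((p.factorial : ℂ) * (q.factorial : ℂ))⁻¹ • ∑ σ : Equiv.Perm (Fin (p + q)),
    (((LinearMap.mul' ℂ ℂ).compMultilinearMap (φ.domCoprod ψ)).domDomCongr
      finSumFinEquiv).domDomCongr σ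

theorem cupForm_apply {p q : ℕ} (φ : 𝔞.Form p) (ψ : 𝔞.Form q) (x : Fin (p + q) → 𝔞.odd) :
    cupForm φ ψ x = 𝔞.cup φ ψ x := by
  simp [cupForm, cup]

theorem cupForm_symm {p q : ℕ} (φ : 𝔞.Form p) (ψ : 𝔞.Form q) (τ : Equiv.Perm (Fin (p + q)))
    (x : Fin (p + q) → 𝔞.odd) : cupForm φ ψ (fun i => x (τ i)) = cupForm φ ψ x := by
  simp only [cupForm_apply, cup]
  congr 1
  exact Fintype.sum_equiv (Equiv.mulLeft τ) _ _ fun σ => rfl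

theorem mem_cocycles_of_lie_eq_zero (h : ∀ (X : 𝔞.even) (x : 𝔞.odd), ⁅X, x⁆ = 0) {n : ℕ}
    {φ : 𝔞.Form n} (hφ : ∀ (σ : Equiv.Perm (Fin n)) (x : Fin n → 𝔞.odd),
      φ (fun i => x (σ i)) = φ x) : φ ∈ 𝔞.cocycles n :=
  mem_cocycles_iff.2 ⟨hφ, fun X x => Finset.sum_eq_zero fun i _ => by
    rw [h, φ.map_update_zero]⟩

theorem prod_mem_pow {R A : Type*} [CommSemiring R] [CommSemiring A] [Algebra R A]
    {M : Submodule R A} {n : ℕ} {f : Fin n → A} (h : ∀ i, f i ∈ M) : ∏ i, f i ∈ M ^ n := by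
  induction n with
  | zero => simpa using (Submodule.one_le (P := (1 : Submodule R A))).1 le_rfl
  | succ n ih =>
    rw [Fin.prod_univ_castSucc, pow_succ]
    exact Submodule.mul_mem_mul (ih fun i => h _) (h _)

/-! ### Symmetric forms versus the symmetric algebra. -/

section SymmetricAlgebra

variable (𝔞) [FiniteDimensional ℂ 𝔞.odd]

/-- The symmetric tensor of a form, normalized so that polarization recovers symmetric forms. -/
def formToSym (n : ℕ) : 𝔞.Form n →ₗ[ℂ] SymmetricAlgebra ℂ (Module.Dual ℂ 𝔞.odd) where
  toFun φ := (n.factorial : ℂ)⁻¹ • ∑ i : Fin n → Fin (Module.finrank ℂ 𝔞.odd),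
    φ (fun k => Module.finBasis ℂ 𝔞.odd (i k)) •
      ∏ k, SymmetricAlgebra.ι ℂ _ ((Module.finBasis ℂ 𝔞.odd).coord (i k))
  map_add' φ ψ := by simp [add_smul, Finset.sum_add_distrib]
  map_smul' c φ := by
    simp only [_root_.smul_apply, smul_assoc, ← Finset.smul_sum, smul_comm _ c, RingHom.id_apply]

theorem formToSym_apply {n : ℕ} (φ : 𝔞.Form n) : 𝔞.formToSym n φ =
    (n.factorial : ℂ)⁻¹ • ∑ i : Fin n → Fin (Module.finrank ℂ 𝔞.odd),
      φ (fun k => Module.finBasis ℂ 𝔞.odd (i k)) •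
        ∏ k, SymmetricAlgebra.ι ℂ _ ((Module.finBasis ℂ 𝔞.odd).coord (i k)) := rfl

theorem formToSym_mem {n : ℕ} (φ : 𝔞.Form n) : 𝔞.formToSym n φ ∈ symPower 𝔞.odd n := by
  rw [formToSym_apply]
  exact Submodule.smul_mem _ _ (Submodule.sum_mem _ fun i _ => Submodule.smul_mem _ _
    (prod_mem_pow fun k => LinearMap.mem_range_self _ _))

/-- As the symmetric algebra is commutative, all `(p + q)!` permutations contribute the same
product. This factor cancels the normalization of `formToSym` in degree `p + q`, and the factor `1 /
(p! q!)` of the cup product supplies those in degrees `p` and `q`. -/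
theorem formToSym_cupForm {p q : ℕ} (φ : 𝔞.Form p) (ψ : 𝔞.Form q) :
    𝔞.formToSym (p + q) (cupForm φ ψ) = 𝔞.formToSym p φ * 𝔞.formToSym q ψ := by
  set b := Module.finBasis ℂ 𝔞.odd
  set c := fun j => SymmetricAlgebra.ι ℂ _ (b.coord j) with hc
  have h : ∀ σ : Equiv.Perm (Fin (p + q)), (∑ i : Fin (p + q) → Fin (Module.finrank ℂ 𝔞.odd),
      (φ (fun k => b (i (σ (Fin.castAdd q k)))) * ψ (fun k => b (i (σ (Fin.natAdd p k))))) •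
        ∏ k, c (i k)) =
      (∑ i : Fin p → _, φ (fun k => b (i k)) • ∏ k, c (i k)) *
        ∑ i : Fin q → _, ψ (fun k => b (i k)) • ∏ k, c (i k) := by
    intro σ
    rw [Finset.sum_mul_sum, ← Finset.sum_product', Finset.univ_product_univ]
    -- Reindex by `i ↦ i ∘ σ`, then cut the multi-index into its first `p` and last `q` entries.
    refine Fintype.sum_equiv ((σ.symm.arrowCongr (Equiv.refl _)).trans
      (Fin.appendEquiv p q).symm) _ _ fun (i : Fin (p + q) → Fin (Module.finrank ℂ 𝔞.odd)) => ?_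
    have e := Equiv.prod_comp σ (fun k => c (i k))
    rw [Fin.prod_univ_add] at e
    rw [← e, smul_mul_smul_comm]
    rfl
  simp only [formToSym_apply, cupForm_apply, cup, Finset.mul_sum, Finset.sum_smul]
  rw [Finset.sum_comm]
  simp only [mul_smul _ (_ * _), ← Finset.smul_sum]
  rw [Finset.sum_congr rfl fun σ _ => h σ, Finset.sum_const, Finset.card_univ, Fintype.card_perm,
    Fintype.card_fin, ← Nat.cast_smul_eq_nsmul ℂ, smul_mul_smul_comm, smul_smul, smul_smul]
  congr 1
  have := Nat.cast_ne_zero (R := ℂ).2 (Nat.factorial_ne_zero (p + q))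
  rw [mul_inv]
  field_simp

/-- The complete polarization of an element of the symmetric algebra `S^•(V^*)`, evaluated at
`x₁, …, xₙ`: the coefficient of `t₁ ⋯ tₙ` in its value at `t₁ x₁ + ⋯ + tₙ xₙ`. -/
def polarize {V : Type u} [AddCommGroup V] [Module ℂ V] {n : ℕ} (x : Fin n → V) :
    SymmetricAlgebra ℂ (Module.Dual ℂ V) →ₗ[ℂ] ℂ :=
  MvPolynomial.lcoeff ℂ (∑ k : Fin n, Finsupp.single k 1) ∘ₗ
    (SymmetricAlgebra.lift (∑ k : Fin n,
      (LinearMap.toSpanSingleton ℂ (MvPolynomial (Fin n) ℂ) (MvPolynomial.X k)) ∘ₗ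
        Module.Dual.eval ℂ V (x k))).toLinearMap

theorem polarize_prod {V : Type u} [AddCommGroup V] [Module ℂ V] {n : ℕ} (x : Fin n → V)
    (l : Fin n → Module.Dual ℂ V) :
    polarize x (∏ k, SymmetricAlgebra.ι ℂ _ (l k)) =
      ∑ σ : Equiv.Perm (Fin n), ∏ k, l k (x (σ k)) := by
  -- Expanding the product of the linear forms gives one term for each choice `f` of a variable per
  -- factor; its monomial is `t₁ ⋯ tₙ` exactly when `f` is a bijection.
  have h : ∀ f : Fin n → Fin n, MvPolynomial.lcoeff ℂ (∑ k : Fin n, Finsupp.single k 1)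
      (∏ k, l k (x (f k)) • (MvPolynomial.X (f k) : MvPolynomial (Fin n) ℂ)) =
      if Function.Bijective f then ∏ k, l k (x (f k)) else 0 := by
    intro f
    have e : ∏ k, l k (x (f k)) • (MvPolynomial.X (f k) : MvPolynomial (Fin n) ℂ) =
        MvPolynomial.monomial (∑ k, Finsupp.single (f k) 1) (∏ k, l k (x (f k))) := by
      rw [MvPolynomial.monomial_sum_prod]
      simp [MvPolynomial.X, MvPolynomial.smul_monomial]
    rw [e, MvPolynomial.lcoeff_apply, MvPolynomial.coeff_monomial]
    refine if_congr ⟨fun h => ?_, fun h => ?_⟩ rfl rfl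
    · refine Finite.surjective_iff_bijective.1 fun j => ?_
      by_contra hj
      have := DFunLike.congr_fun h j
      push Not at hj
      simp [Finsupp.finsetSum_apply, Finsupp.single_apply, hj] at this
    · exact Function.Bijective.sum_comp h (fun k => Finsupp.single k 1)
  simp only [polarize, LinearMap.comp_apply, AlgHom.toLinearMap_apply, map_prod,
    SymmetricAlgebra.lift_ι_apply, LinearMap.sum_apply, LinearMap.toSpanSingleton_apply,
    Module.Dual.eval_apply]
  rw [Finset.prod_univ_sum, map_sum, Fintype.piFinset_univ, Finset.sum_congr rfl fun f _ => h f,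
    ← Finset.sum_filter]
  symm
  refine Finset.sum_bij (fun σ _ => σ)
    (fun σ _ => Finset.mem_filter.2 ⟨Finset.mem_univ _, σ.bijective⟩)
    (fun σ _ τ _ h => DFunLike.coe_injective h) (fun f hf => ?_) fun σ _ => rfl
  exact ⟨Equiv.ofBijective f (Finset.mem_filter.1 hf).2, Finset.mem_univ _, rfl⟩

variable {𝔞} in
-- Polarizing a product of coordinates sums over permutations of the arguments. By multilinear
-- expansion in the basis each permutation gives `φ` at the permuted arguments, which is `φ x` by
-- symmetry; the `n!` equal terms cancel the normalization.
theorem polarize_formToSym {n : ℕ} {φ : 𝔞.Form n}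
    (hφ : ∀ (σ : Equiv.Perm (Fin n)) (x : Fin n → 𝔞.odd), φ (fun i => x (σ i)) = φ x)
    (x : Fin n → 𝔞.odd) : polarize x (𝔞.formToSym n φ) = φ x := by
  set b := Module.finBasis ℂ 𝔞.odd
  have h : ∀ y : Fin n → 𝔞.odd, ∑ i : Fin n → Fin (Module.finrank ℂ 𝔞.odd),
      φ (fun k => b (i k)) * ∏ k, b.coord (i k) (y k) = φ y := by
    intro y
    conv_rhs => rw [← funext fun k => b.sum_repr (y k), φ.map_sum]
    refine Finset.sum_congr rfl fun i _ => ?_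
    rw [φ.map_smul_univ, smul_eq_mul, mul_comm]
    rfl
  simp only [formToSym_apply, map_smul, map_sum, polarize_prod, smul_eq_mul]
  have := Nat.cast_ne_zero (R := ℂ).2 (Nat.factorial_ne_zero n)
  rw [inv_mul_eq_iff_eq_mul₀ this]
  simp only [Finset.mul_sum]
  rw [Finset.sum_comm, Finset.sum_congr rfl fun σ _ => (h (fun k => x (σ k))).trans (hφ σ x)]
  simp [Fintype.card_perm]

/-- The map from cocycles to `S^n(𝔞₁^*)`, bijective if `𝔞₀` acts trivially on `𝔞₁`. -/
def cocyclesToSym (n : ℕ) : 𝔞.cocycles n →ₗ[ℂ] symPower 𝔞.odd n :=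
  ((𝔞.formToSym n).codRestrict _ 𝔞.formToSym_mem).domRestrict _

/-- Injectivity comes from polarization. Surjectivity is by induction on the degree: multiplication
by a linear form is the cup product with a form of degree one. -/
theorem cocyclesToSym_bijective (h : ∀ (X : 𝔞.even) (x : 𝔞.odd), ⁅X, x⁆ = 0) (n : ℕ) :
    Function.Bijective (𝔞.cocyclesToSym n) := by
  constructor
  · intro φ ψ e
    ext x
    rw [← polarize_formToSym φ.2.1.1, ← polarize_formToSym ψ.2.1.1]
    exact congrArg (polarize x) (congrArg Subtype.val e)
  · have key : ∀ a ∈ symPower 𝔞.odd n, ∃ φ ∈ 𝔞.cocycles n, 𝔞.formToSym n φ = a := by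
      induction n with
      | zero =>
        intro a ha
        rw [symPower, pow_zero] at ha
        obtain ⟨c, rfl⟩ := Submodule.mem_one.1 ha
        refine ⟨MultilinearMap.constOfIsEmpty ℂ _ c,
          mem_cocycles_of_lie_eq_zero h fun σ x => by simp, ?_⟩
        simp [formToSym_apply, Algebra.algebraMap_eq_smul_one]
      | succ n ih =>
        intro a ha
        rw [symPower, pow_succ] at ha
        refine Submodule.mul_induction_on ha ?_ ?_
        · rintro a ha _ ⟨l, rfl⟩
          -- That `φ` is a cocycle is not needed: the cup product is symmetric anyway, and
          -- invariance is automatic.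
          obtain ⟨φ, -, rfl⟩ := ih a ha
          refine ⟨cupForm φ (MultilinearMap.ofSubsingleton ℂ _ _ (0 : Fin 1) l),
            mem_cocycles_of_lie_eq_zero h (cupForm_symm _ _), ?_⟩
          rw [formToSym_cupForm]
          congr 1
          rw [formToSym_apply, ← Equiv.sum_comp (Equiv.funUnique (Fin 1) _).symm]
          simp only [Nat.factorial_one, Nat.cast_one, inv_one, one_smul, Fin.prod_univ_one,
            ← map_smul, ← map_sum]
          exact congrArg _ ((Module.finBasis ℂ 𝔞.odd).sum_dual_apply_smul_coord l)
        · rintro _ _ ⟨φ, hφ, rfl⟩ ⟨ψ, hψ, rfl⟩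
          exact ⟨φ + ψ, add_mem hφ hψ, map_add _ _ _⟩
    rintro ⟨a, ha⟩
    obtain ⟨φ, hφ, e⟩ := key a ha
    exact ⟨⟨φ, hφ⟩, Subtype.ext e⟩

/-- `H^•(𝔞, 𝔞₀; ℂ) ≅ S^•(𝔞₁^*)` as graded algebras if `𝔞₀` acts trivially on `𝔞₁`. -/
theorem exists_symPower_equiv_H (h : ∀ (X : 𝔞.even) (x : 𝔞.odd), ⁅X, x⁆ = 0) :
    ∃ e : ∀ n : ℕ, symPower 𝔞.odd n ≃ₗ[ℂ] 𝔞.H n,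
      ∀ (p q : ℕ) (a : symPower 𝔞.odd p) (b : symPower 𝔞.odd q) (c : symPower 𝔞.odd (p + q)),
        (c : SymmetricAlgebra ℂ (Module.Dual ℂ 𝔞.odd)) = a * b →
          𝔞.IsCup (e p a) (e q b) (e (p + q) c) := by
  let E := fun n => LinearEquiv.ofBijective _ (𝔞.cocyclesToSym_bijective h n)
  refine ⟨fun n => (E n).symm.trans (H.mkEquiv 𝔞 n), fun p q a b c habc => ?_⟩
  obtain ⟨φ, rfl⟩ := (E p).surjective a
  obtain ⟨ψ, rfl⟩ := (E q).surjective b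
  have hc : E (p + q) ⟨cupForm φ.1 ψ.1, mem_cocycles_of_lie_eq_zero h (cupForm_symm _ _)⟩ = c :=
    Subtype.ext ((𝔞.formToSym_cupForm φ.1 ψ.1).trans habc.symm)
  rw [← hc]
  simp only [LinearEquiv.trans_apply, LinearEquiv.symm_apply_apply]
  exact ⟨φ, ψ, _, rfl, rfl, rfl, cupForm_apply _ _⟩

end SymmetricAlgebra

end LieSuperalgebra

/-! ### Invariance of forms, tested on spanning sets. -/

namespace LieSuperalgebra

variable {𝔞 : LieSuperalgebra.{u}}

theorem Form.ext_of_span_eq_top {s : Set 𝔞.odd} (hs : Submodule.span ℂ s = ⊤) {n : ℕ}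
    {φ ψ : 𝔞.Form n} (h : ∀ x : Fin n → 𝔞.odd, (∀ i, x i ∈ s) → φ x = ψ x) : φ = ψ :=
  Module.Basis.ext_multilinear (fun _ => Module.Basis.ofSpan hs.ge) fun v =>
    h _ fun i => Module.Basis.ofSpan_subset hs.ge ⟨v i, rfl⟩

/-- The (negative of the) action of `X ∈ 𝔞₀` on forms. -/
def lieForm (X : 𝔞.even) {n : ℕ} (φ : 𝔞.Form n) : 𝔞.Form n :=
  ∑ i, φ.compLinearMap (Function.update (fun _ => LinearMap.id) i
    (LieModule.toEnd ℂ 𝔞.even 𝔞.odd X))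

theorem lieForm_apply (X : 𝔞.even) {n : ℕ} (φ : 𝔞.Form n) (x : Fin n → 𝔞.odd) :
    lieForm X φ x = ∑ i, φ (Function.update x i ⁅X, x i⁆) := by
  simp only [lieForm, _root_.sum_apply, MultilinearMap.compLinearMap_apply]
  refine Finset.sum_congr rfl fun i _ => congrArg φ (funext fun j => ?_)
  rcases eq_or_ne j i with rfl | h
  · simp
  · simp [h]

theorem lieForm_add (X Y : 𝔞.even) {n : ℕ} (φ : 𝔞.Form n) :
    lieForm (X + Y) φ = lieForm X φ + lieForm Y φ := by
  ext x
  simp only [_root_.add_apply, lieForm_apply, add_lie, φ.map_update_add, Finset.sum_add_distrib]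

theorem lieForm_apply_of_eigen {X : 𝔞.even} {n : ℕ} (φ : 𝔞.Form n) {x : Fin n → 𝔞.odd}
    {c : Fin n → ℂ} (h : ∀ i, ⁅X, x i⁆ = c i • x i) : lieForm X φ x = (∑ i, c i) * φ x := by
  rw [lieForm_apply, Finset.sum_mul]
  refine Finset.sum_congr rfl fun i _ => ?_
  rw [h, φ.map_update_smul, Function.update_eq_self, smul_eq_mul]

theorem mem_cochains_iff {n : ℕ} {φ : 𝔞.Form n} : φ ∈ 𝔞.cochains n ↔
    (∀ (σ : Equiv.Perm (Fin n)) (x : Fin n → 𝔞.odd), φ (fun i => x (σ i)) = φ x) ∧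
      ∀ X : 𝔞.even, lieForm X φ = 0 :=
  and_congr_right fun _ => forall_congr' fun X => by
    simp [MultilinearMap.ext_iff, lieForm_apply]

end LieSuperalgebra

/-! ### Passage between `T₀` and `𝔱₀` through one-parameter subgroups. -/

namespace ClassicalStructure

open LieSuperalgebra

variable {𝔤 : LieSuperalgebra.{u}} {C : ClassicalStructure 𝔤}

/-- Differentiate at `s = 0`. This turns invariance under a one-parameter group into infinitesimal
invariance. -/
theorem mul_eq_zero_of_exp_mul_eq {a z : ℂ} (h : ∀ s : ℂ, Complex.exp (s * a) * z = z) :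
    a * z = 0 := by
  have h1 : HasDerivAt (fun s : ℂ => Complex.exp (s * a) * z) (a * z) 0 := by
    simpa using (((hasDerivAt_id (0 : ℂ)).mul_const a).cexp).mul_const z
  simp only [h] at h1
  exact h1.unique (hasDerivAt_const 0 z)

/-- Each matrix coefficient of the curve solves `f' = β f`, so its product with `exp (-s β)` is
constant. -/
theorem r_curve_apply {X : 𝔤.even} {c : ℂ → C.G}
    (hc : ∀ s, ((c s : Matrix.GeneralLinearGroup (Fin C.N) ℂ) : Matrix (Fin C.N) (Fin C.N) ℂ) =
      NormedSpace.exp (s • C.ρ X)) {x : 𝔤.odd} {β : ℂ} (hx : ⁅X, x⁆ = β • x) (s : ℂ) :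
    C.r (c s) x = Complex.exp (s * β) • x := by
  have hadd : ∀ a b, c (a + b) = c a * c b := fun a b => by
    refine Subtype.ext (Units.ext ?_)
    rw [hc, Subgroup.coe_mul, Units.val_mul, hc, hc, add_smul]
    exact Matrix.exp_add_of_commute _ _ (((Commute.refl _).smul_left _).smul_right _)
  have h0 : c 0 = 1 := by
    have := hadd 0 0
    rw [add_zero] at this
    exact left_eq_mul.1 this
  refine sub_eq_zero.1 ((Module.forall_dual_apply_eq_zero_iff ℂ _).1 fun l => ?_)
  rw [map_sub, sub_eq_zero]
  have hd : ∀ a, HasDerivAt (fun s => l (C.r (c s) x)) (β * l (C.r (c a) x)) a := fun a => by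
    -- The derivative is given only at `0`; composing the functional with `r (c a)` moves it to `a`,
    -- since `c` is a homomorphism.
    have h := C.r_differential X c hc x (l ∘ₗ C.r (c a))
    rw [← sub_self a] at h
    have h' := h.comp_sub_const a a
    simp only [hx, map_smul, smul_eq_mul, LinearMap.comp_apply] at h'
    refine h'.congr_of_eventuallyEq (Filter.Eventually.of_forall fun b => ?_)
    beta_reduce
    rw [← Module.End.mul_apply, ← map_mul, ← hadd, add_sub_cancel]
  have hconst : ∀ a, HasDerivAt (fun s => l (C.r (c s) x) * Complex.exp (-(s * β))) 0 a :=
    fun a => by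
      have h := (hd a).mul ((((hasDerivAt_id a).mul_const β).neg).cexp)
      refine h.congr_deriv ?_
      simp only [id_eq]
      ring
  have := is_const_of_deriv_eq_zero (fun a => (hconst a).differentiableAt)
    (fun a => (hconst a).deriv) s 0
  simp only [h0, map_one, Module.End.one_apply, zero_mul, neg_zero, Complex.exp_zero,
    mul_one] at this
  rw [map_smul, smul_eq_mul, ← this, mul_left_comm, ← Complex.exp_add, add_neg_cancel,
    Complex.exp_zero, mul_one]

namespace MaximalTorus

variable (T : C.MaximalTorus)

theorem exists_curve {X : 𝔤.even} (hX : X ∈ T.t) : ∃ c : ℂ → C.G,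
    (∀ s, (c s : Matrix.GeneralLinearGroup (Fin C.N) ℂ) ∈ T.T) ∧
    ∀ s, ((c s : Matrix.GeneralLinearGroup (Fin C.N) ℂ) : Matrix (Fin C.N) (Fin C.N) ℂ) =
      NormedSpace.exp (s • C.ρ X) := by
  choose c hc hc' using (T.mem_t X).1 hX
  exact ⟨fun s => ⟨c s, T.le (hc s)⟩, hc, hc'⟩

/-- The exponential map of a torus is surjective: take logarithms of the torus coordinates of `g`.
The matrix `M` uses the same integer exponents as `T₀`, so all `exp (z M)` stay in the torus. -/
theorem exists_curve_through {g : C.G} (hg : (g : Matrix.GeneralLinearGroup (Fin C.N) ℂ) ∈ T.T) :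
    ∃ X ∈ T.t, ∃ c : ℂ → C.G,
      (∀ s, ((c s : Matrix.GeneralLinearGroup (Fin C.N) ℂ) : Matrix (Fin C.N) (Fin C.N) ℂ) =
        NormedSpace.exp (s • C.ρ X)) ∧ c 1 = g := by
  obtain ⟨d, Q, a, hT⟩ := T.isTorus
  obtain ⟨s, hs⟩ := (hT _).1 hg
  set M : Matrix (Fin C.N) (Fin C.N) ℂ := (Q : Matrix (Fin C.N) (Fin C.N) ℂ) *
    Matrix.diagonal (fun k => ∑ j, (a k j : ℂ) * Complex.log (s j)) *
      ((Q⁻¹ : Matrix.GeneralLinearGroup (Fin C.N) ℂ) : Matrix (Fin C.N) (Fin C.N) ℂ) with hM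
  have hexp : ∀ z : ℂ, NormedSpace.exp (z • M) = (Q : Matrix (Fin C.N) (Fin C.N) ℂ) *
      Matrix.diagonal (fun k => ∏ j, (Complex.exp (z * Complex.log (s j))) ^ a k j) *
      ((Q⁻¹ : Matrix.GeneralLinearGroup (Fin C.N) ℂ) : Matrix (Fin C.N) (Fin C.N) ℂ) := by
    intro z
    rw [hM, ← smul_mul_assoc, ← mul_smul_comm, Matrix.exp_units_conj, ← Matrix.diagonal_smul,
      Matrix.exp_diagonal]
    congr 3
    funext k
    rw [Pi.coe_exp, ← Complex.exp_eq_exp_ℂ]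
    simp only [Pi.smul_apply, smul_eq_mul, Finset.mul_sum, Complex.exp_sum]
    refine Finset.prod_congr rfl fun j _ => ?_
    rw [← Complex.exp_int_mul]
    ring_nf
  have hLie : LinAlgGroup.InLie T.T M := by
    intro z
    obtain ⟨g, hg⟩ := Matrix.isUnit_exp (z • M)
    exact ⟨g, (hT g).2 ⟨fun j => Units.mk0 _ (Complex.exp_ne_zero (z * Complex.log (s j))),
      hg.trans (hexp z)⟩, hg⟩
  obtain ⟨X, hX⟩ := (C.ρ_range M).2 fun z => (hLie z).imp fun g hg => ⟨T.le hg.1, hg.2⟩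
  have hXt : X ∈ T.t := (T.mem_t X).2 (hX ▸ hLie)
  obtain ⟨c, -, hc⟩ := T.exists_curve hXt
  refine ⟨X, hXt, c, hc, Subtype.ext (Units.ext ?_)⟩
  rw [hc, hs, hX, hexp]
  simp only [one_mul, Complex.exp_log (Units.ne_zero _)]

theorem iSupIndep_oddWeight : iSupIndep T.oddWeight := by
  classical
  rw [iSupIndep_iff_finsetSum_eq_zero_imp_eq_zero]
  intro s
  induction s using Finset.induction_on with
  | empty => simp
  | insert β s hβ ih =>
    intro v hv h0
    have hs : ∀ α ∈ s, v α = 0 := fun α hα => by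
      obtain ⟨h, hh⟩ : ∃ h, α h ≠ β h := by
        by_contra! e
        exact hβ (LinearMap.ext e ▸ hα)
      -- Acting by `h` and subtracting `β h` times the relation eliminates the `β`-term.
      have key := ih (fun α => (α h - β h) • v α)
        (fun α hα => Submodule.smul_mem _ _ (hv α (Finset.mem_insert_of_mem hα))) ?_ α hα
      · exact (smul_eq_zero.1 key).resolve_left (sub_ne_zero.2 hh)
      · have h1 : ∑ α ∈ insert β s, α h • v α = 0 := by
          rw [← lie_zero (h : 𝔤.even), ← h0, lie_sum]
          exact Finset.sum_congr rfl fun α hα => (hv α hα h).symm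
        have h2 : ∑ α ∈ insert β s, β h • v α = 0 := by rw [← Finset.smul_sum, h0, smul_zero]
        have h3 : ∑ α ∈ insert β s, (α h - β h) • v α = 0 := by
          simp only [sub_smul, Finset.sum_sub_distrib, h1, h2, sub_zero]
        rwa [Finset.sum_insert hβ, sub_self, zero_smul, zero_add] at h3
    intro α hα
    rcases Finset.mem_insert.1 hα with rfl | hα
    · rwa [Finset.sum_insert hβ, Finset.sum_eq_zero hs, add_zero] at h0
    · exact hs α hα

/-! ### Weights on the hyperplane and the trivial action of `𝔣₀` on `𝔣₁`. -/

namespace ParabolicFunctional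

variable {T} {x₀ : 𝔤.odd} (P : T.ParabolicFunctional x₀)

theorem disjoint_detectingOdd_uOdd : Disjoint (C.detectingOdd x₀) P.uOdd := by
  rw [P.f_odd]
  exact T.iSupIndep_oddWeight.disjoint_biSup_biSup
    (Set.disjoint_left.2 fun α (h : P.𝓗 α = 0) (h' : P.𝓗 α < 0) => h'.ne h)

theorem oddWeight_le_detectingOdd {α : Module.Dual ℂ T.t} (h : P.𝓗 α = 0) :
    T.oddWeight α ≤ C.detectingOdd x₀ := by
  rw [P.f_odd]
  exact le_iSup₂_of_le (f := fun α (_ : α ∈ {α : Module.Dual ℂ T.t | P.𝓗 α = 0}) => T.oddWeight α)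
    α h le_rfl

theorem detectingOdd_le {S : Submodule ℂ 𝔤.odd}
    (h : ∀ α : Module.Dual ℂ T.t, P.𝓗 α = 0 → ∀ x ∈ T.oddWeight α, x ∈ S) :
    C.detectingOdd x₀ ≤ S := by
  rw [P.f_odd]
  exact iSup₂_le h

/-- The weight vectors of `𝔣₁`. -/
def fWeightVectors : Set (C.detectingOdd x₀) := {x | ∃ α, P.𝓗 α = 0 ∧ x.1 ∈ T.oddWeight α}

/-- The weight vectors of `𝔟₁`. -/
def bWeightVectors : Set P.bOdd := {x | ∃ α, P.𝓗 α ≤ 0 ∧ x.1 ∈ T.oddWeight α}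

theorem span_fWeightVectors : Submodule.span ℂ P.fWeightVectors = ⊤ := by
  have h : C.detectingOdd x₀ ≤ (Submodule.span ℂ P.fWeightVectors).map (Submodule.subtype _) :=
    P.detectingOdd_le fun α hα x hx =>
      ⟨⟨x, P.oddWeight_le_detectingOdd hα hx⟩, Submodule.subset_span ⟨α, hα, hx⟩, rfl⟩
  refine eq_top_iff.2 fun x _ => ?_
  obtain ⟨y, hy, e⟩ := h x.2
  exact (Subtype.ext e : y = x) ▸ hy

theorem span_bWeightVectors : Submodule.span ℂ P.bWeightVectors = ⊤ := by
  have h : P.bOdd ≤ (Submodule.span ℂ P.bWeightVectors).map (Submodule.subtype _) :=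
    P.bOdd_le fun α hα x hx =>
      ⟨⟨x, P.oddWeight_le_bOdd hα hx⟩, Submodule.subset_span ⟨α, hα, hx⟩, rfl⟩
  refine eq_top_iff.2 fun x _ => ?_
  obtain ⟨y, hy, e⟩ := h x.2
  exact (Subtype.ext e : y = x) ▸ hy

include P in
theorem br_eq_zero_of_add_ne_zero {α β : Module.Dual ℂ T.t} (hα : P.𝓗 α = 0) (hβ : P.𝓗 β = 0)
    (h : α + β ≠ 0) {x y : 𝔤.odd} (hx : x ∈ T.oddWeight α) (hy : y ∈ T.oddWeight β) :
    𝔤.br x y = 0 := by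
  have h' : T.evenWeight (α + β) = ⊥ := by
    by_contra e
    exact P.regular _ h e (by rw [map_add, hα, hβ, add_zero])
  exact (Submodule.mem_bot ℂ).1 (h' ▸ br_oddWeight hx hy)

/-- Only `β = -α` matters. If `γ` is not `±α`, the other two Jacobi terms vanish. Otherwise `[x, y]
∈ 𝔱₀` acts on `z` by the scalar `±α([x, y])`, which is zero by the action on `x`. -/
theorem br_lie_weight {α β γ : Module.Dual ℂ T.t} (hα : P.𝓗 α = 0) (hβ : P.𝓗 β = 0)
    (hγ : P.𝓗 γ = 0) {x y z : 𝔤.odd} (hx : x ∈ T.oddWeight α) (hy : y ∈ T.oddWeight β)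
    (hz : z ∈ T.oddWeight γ) : ⁅𝔤.br x y, z⁆ = 0 := by
  have act : ∀ {a b c : Module.Dual ℂ T.t} {u v w : 𝔤.odd}, P.𝓗 a = 0 → P.𝓗 b = 0 →
      ∀ (hu : u ∈ T.oddWeight a) (hv : v ∈ T.oddWeight b) (hw : w ∈ T.oddWeight c),
      ∃ h : 𝔤.br u v ∈ T.t, ⁅𝔤.br u v, w⁆ = c ⟨_, h⟩ • w := fun ha hb hu hv hw =>
    have h := P.f_even (Submodule.subset_span ⟨_, P.oddWeight_le_detectingOdd ha hu, _,
      P.oddWeight_le_detectingOdd hb hv, rfl⟩)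
    ⟨h, hw ⟨_, h⟩⟩
  by_cases hαβ : α + β = 0
  swap
  · rw [P.br_eq_zero_of_add_ne_zero hα hβ hαβ hx hy, zero_lie]
  obtain rfl : β = -α := (neg_eq_of_add_eq_zero_right hαβ).symm
  have self : ∀ α : Module.Dual ℂ T.t, P.𝓗 α = 0 → ∀ x ∈ T.oddWeight α,
      ∀ y ∈ T.oddWeight (-α), ⁅𝔤.br x y, x⁆ = 0 := by
    intro α hα x hx y hy
    have hα' : P.𝓗 (-α) = 0 := by rw [map_neg, hα, neg_zero]
    by_cases h : α = 0
    · subst h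
      obtain ⟨h, e⟩ := act hα hα' hx hy hx
      rw [e, LinearMap.zero_apply, zero_smul]
    -- For `α ≠ 0` the weight `2α` is nonzero and on the hyperplane, so `[x, x] = 0`, and Jacobi for
    -- `x, y, x` reads `2 [[x, y], x] = 0`.
    · have hxx : 𝔤.br x x = 0 := P.br_eq_zero_of_add_ne_zero hα hα
        (fun e => h ((smul_eq_zero.1 ((two_smul ℂ α).trans e)).resolve_left two_ne_zero)) hx hx
      have j := 𝔤.jacobi x y x
      rw [hxx, zero_lie, add_zero, 𝔤.br_symm y x, ← two_smul ℂ, smul_eq_zero] at j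
      exact j.resolve_left two_ne_zero
  by_cases hz0 : γ = α ∨ γ = -α
  · have ha : ⁅𝔤.br x y, x⁆ = 0 := self α hα x hx y hy
    by_cases hx0 : x = 0
    · rw [hx0, map_zero, LinearMap.zero_apply, zero_lie]
    obtain ⟨h, e⟩ := act hα hβ hx hy hx
    obtain ⟨h', e'⟩ := act hα hβ hx hy hz
    rw [e, smul_eq_zero, or_iff_left hx0] at ha
    rw [e']
    rcases hz0 with rfl | rfl
    · rw [ha, zero_smul]
    · rw [LinearMap.neg_apply, ha, neg_zero, zero_smul]
  · rw [not_or] at hz0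
    have j := 𝔤.jacobi x y z
    rwa [P.br_eq_zero_of_add_ne_zero hβ hγ
        (fun e => hz0.1 (by simpa using eq_neg_of_add_eq_zero_right e)) hy hz,
      P.br_eq_zero_of_add_ne_zero hγ hα (fun e => hz0.2 (eq_neg_of_add_eq_zero_left e)) hz hx,
      zero_lie, zero_lie, add_zero, add_zero] at j

include P in
/-- `𝔣₀` acts trivially on `𝔣₁`. -/
theorem lie_detecting_eq_zero (X : (C.detecting x₀).toLieSuperalgebra.even)
    (x : (C.detecting x₀).toLieSuperalgebra.odd) : ⁅X, x⁆ = 0 := by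
  have h : ∀ z ∈ C.detectingOdd x₀, ∀ X ∈ C.detectingEven x₀, ⁅X, z⁆ = 0 := by
    intro z hz
    suffices h : C.detectingEven x₀ ≤ LinearMap.ker ((lieOdd 𝔤).flip z) from h
    refine Submodule.span_le.2 ?_
    rintro _ ⟨x, hx, y, hy, rfl⟩
    have h1 : C.detectingOdd x₀ ≤ LinearMap.ker (lieOdd 𝔤 (𝔤.br x y)) :=
      P.detectingOdd_le fun γ hγ z hz => by
        have h2 : C.detectingOdd x₀ ≤ LinearMap.ker ((lieOdd 𝔤).flip z ∘ₗ 𝔤.br x) :=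
          P.detectingOdd_le fun β hβ y hy => by
            have h3 : C.detectingOdd x₀ ≤ LinearMap.ker ((lieOdd 𝔤).flip z ∘ₗ 𝔤.br.flip y) :=
              P.detectingOdd_le fun α hα x hx => P.br_lie_weight hα hβ hγ hx hy hz
            exact h3 hx
        exact h2 hy
    exact h1 hz
  exact Subtype.ext (h x.1 x.2 X.1 X.2)

/-! ### Injectivity of restriction and invariance of its image. -/

theorem eq_zero_of_weight_neg {n : ℕ} {φ : P.parabolic.toLieSuperalgebra.Form n}
    (hφ : φ ∈ P.parabolic.toLieSuperalgebra.cochains n) {x : Fin n → P.bOdd}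
    {α : Fin n → Module.Dual ℂ T.t} (hα : ∀ i, P.𝓗 (α i) ≤ 0)
    (hx : ∀ i, (x i).1 ∈ T.oddWeight (α i)) {k : Fin n} (hk : P.𝓗 (α k) < 0) : φ x = 0 := by
  by_contra h0
  have hsum : ∑ i, α i = 0 := by
    ext h
    have e := lieForm_apply_of_eigen (𝔞 := P.parabolic.toLieSuperalgebra)
      (X := ⟨h.1, Submodule.mem_sup_left h.2⟩) φ (x := x) (c := fun i => α i h)
      (fun i => Subtype.ext (hx i h))
    have e' := e.symm.trans (DFunLike.congr_fun ((mem_cochains_iff.1 hφ).2 _) x)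
    simpa using (mul_eq_zero.1 e').resolve_right h0
  have hs : ∑ i, P.𝓗 (α i) < 0 :=
    Finset.sum_neg' (fun i _ => hα i) ⟨k, Finset.mem_univ k, hk⟩
  rw [← map_sum, hsum, map_zero] at hs
  exact hs.false

theorem pullForm_detectingInclusion_injective {n : ℕ} {φ : P.parabolic.toLieSuperalgebra.Form n}
    (hφ : φ ∈ P.parabolic.toLieSuperalgebra.cochains n)
    (h : P.detectingInclusion.pullForm n φ = 0) : φ = 0 := by
  refine Form.ext_of_span_eq_top P.span_bWeightVectors fun x hx => ?_
  choose α hα hx using hx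
  by_cases hk : ∃ k, P.𝓗 (α k) < 0
  · obtain ⟨k, hk⟩ := hk
    exact P.eq_zero_of_weight_neg hφ hα hx hk
  · push Not at hk
    exact DFunLike.congr_fun h
      (fun i => ⟨(x i).1, P.oddWeight_le_detectingOdd ((hα i).antisymm (hk i)) (hx i)⟩)

theorem res_injective (n : ℕ) : Function.Injective (P.res n) := by
  refine (injective_iff_map_eq_zero _).2 fun a ha => ?_
  obtain ⟨φ, rfl⟩ := (H.mk_bijective n).2 a
  have h := (H.mk_bijective n).1 (ha.trans (map_zero (H.mkEquiv _ n)).symm)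
  have h' : φ = 0 := Subtype.ext
    (P.pullForm_detectingInclusion_injective φ.2.1 (congrArg Subtype.val h))
  rw [h']
  exact map_zero (H.mkEquiv _ n)

/-- Without coboundaries, invariance of a class is invariance of the form itself. -/
theorem mk_mem_invariants_iff {n : ℕ} (φ : (C.detecting x₀).toLieSuperalgebra.cocycles n) :
    H.mk _ φ ∈ P.invariants n ↔ ∀ (g : C.G)
      (hg : (g : Matrix.GeneralLinearGroup (Fin C.N) ℂ) ∈ T.T),
      (P.torusHom g hg).pullForm n φ = φ := by
  simp only [invariants, Submodule.mem_iInf, LinearMap.mem_eqLocus, Hom.pullback_mk,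
    LinearMap.id_apply]
  exact forall₂_congr fun g hg =>
    ⟨fun h => congrArg Subtype.val ((H.mk_bijective n).1 h), fun h => congrArg _ (Subtype.ext h)⟩

theorem pullForm_torusHom_apply {X : 𝔤.even} (hX : X ∈ T.t) {c : ℂ → C.G}
    (hc : ∀ s, ((c s : Matrix.GeneralLinearGroup (Fin C.N) ℂ) : Matrix (Fin C.N) (Fin C.N) ℂ) =
      NormedSpace.exp (s • C.ρ X)) (s : ℂ)
    (hs : (c s : Matrix.GeneralLinearGroup (Fin C.N) ℂ) ∈ T.T) {n : ℕ}
    (φ : (C.detecting x₀).toLieSuperalgebra.Form n) {x : Fin n → C.detectingOdd x₀}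
    {α : Fin n → Module.Dual ℂ T.t} (hx : ∀ i, (x i).1 ∈ T.oddWeight (α i)) :
    (P.torusHom (c s) hs).pullForm n φ x =
      Complex.exp (s * ∑ i, α i ⟨X, hX⟩) * φ x := by
  rw [Finset.mul_sum, Complex.exp_sum]
  exact (congrArg φ (funext fun i => Subtype.ext (r_curve_apply hc (hx i ⟨X, hX⟩) s))).trans
    (φ.map_smul_univ _ x)

theorem res_mem_invariants {n : ℕ} (a : P.parabolic.toLieSuperalgebra.H n) :
    P.res n a ∈ P.invariants n := by
  obtain ⟨φ, rfl⟩ := (H.mk_bijective n).2 a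
  refine (P.mk_mem_invariants_iff ⟨_, P.detectingInclusion.pullForm_cocycles φ.2⟩).2 fun g hg => ?_
  obtain ⟨X, hX, c, hc, rfl⟩ := T.exists_curve_through hg
  refine Form.ext_of_span_eq_top P.span_fWeightVectors fun x hx => ?_
  choose α hα hx using hx
  rw [P.pullForm_torusHom_apply hX hc 1 hg _ hx, one_mul]
  have e := lieForm_apply_of_eigen (𝔞 := P.parabolic.toLieSuperalgebra)
    (X := ⟨X, Submodule.mem_sup_left hX⟩) φ.1 (x := fun i => P.detectingInclusion.odd (x i))
    (c := fun i => α i ⟨X, hX⟩) (fun i => Subtype.ext (hx i ⟨X, hX⟩))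
  have e' := e.symm.trans (DFunLike.congr_fun ((mem_cochains_iff.1 φ.2.1).2 _) _)
  -- By `𝔱₀`-invariance the total weight at `X` is zero or the value of the form is; either way the
  -- exponential factor has no effect.
  rcases mul_eq_zero.1 e' with h | h
  · rw [h, Complex.exp_zero, one_mul]
  · change _ * φ.1 (fun i => P.detectingInclusion.odd (x i)) =
      φ.1 (fun i => P.detectingInclusion.odd (x i))
    rw [h, mul_zero]

/-! ### Extension of `T₀`-invariant forms from `𝔣₁` to `𝔟₁`. -/

theorem exists_projection : ∃ π : P.bOdd →ₗ[ℂ] C.detectingOdd x₀,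
    (∀ (x : P.bOdd) (h : x.1 ∈ C.detectingOdd x₀), π x = ⟨x.1, h⟩) ∧
      ∀ x : P.bOdd, x.1 ∈ P.uOdd → π x = 0 := by
  -- Enlarge `𝔲₁` to a complement `q` of `𝔣₁` in all of `𝔤₁`, then restrict the projection to `𝔟₁`.
  obtain ⟨q, hq, hc⟩ := P.disjoint_detectingOdd_uOdd.symm.exists_isCompl
  exact ⟨(Submodule.projectionOnto _ q hc.symm).domRestrict P.bOdd,
    fun x h => Submodule.projectionOnto_apply_of_mem_left hc.symm h,
    fun x h => Submodule.projectionOnto_apply_of_mem_right hc.symm (hq h)⟩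

theorem uEven_lie_bOdd {X : 𝔤.even} (hX : X ∈ P.uEven) {x : 𝔤.odd} (hx : x ∈ P.bOdd) :
    ⁅X, x⁆ ∈ P.uOdd := by
  have h : ∀ α, P.𝓗 α < 0 → ∀ X ∈ T.evenWeight α, P.bOdd ≤ P.uOdd.comap (lieOdd 𝔤 X) :=
    fun α hα X hX => P.bOdd_le fun β hβ y hy =>
      P.oddWeight_le_uOdd (α := α + β) (by rw [map_add]; exact add_neg_of_neg_of_nonpos hα hβ)
        (lie_oddWeight hX hy)
  have h' : P.uEven ≤ P.uOdd.comap ((lieOdd 𝔤).flip x) := iSup₂_le fun α hα X hX => h α hα X hX hx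
  exact h' hX

theorem exists_extension {n : ℕ} {φ : (C.detecting x₀).toLieSuperalgebra.Form n}
    (hφ : φ ∈ (C.detecting x₀).toLieSuperalgebra.cochains n)
    (hT : ∀ (g : C.G) (hg : (g : Matrix.GeneralLinearGroup (Fin C.N) ℂ) ∈ T.T),
      (P.torusHom g hg).pullForm n φ = φ) :
    ∃ ψ ∈ P.parabolic.toLieSuperalgebra.cochains n, P.detectingInclusion.pullForm n ψ = φ := by
  obtain ⟨π, hπ, hπ'⟩ := P.exists_projection
  let ψ : P.parabolic.toLieSuperalgebra.Form n := φ.compLinearMap fun _ => π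
  have hψ : ∀ x : Fin n → P.bOdd, ψ x = φ fun i => π (x i) := fun x => rfl
  have hψ0 : ∀ (x : Fin n → P.bOdd) (k : Fin n), (x k).1 ∈ P.uOdd → ψ x = 0 := fun x k hk =>
    φ.map_coord_zero k (hπ' _ hk)
  refine ⟨ψ, mem_cochains_iff.2 ⟨fun σ x => hφ.1 σ fun i => π (x i), fun X => ?_⟩, ?_⟩
  · refine Form.ext_of_span_eq_top P.span_bWeightVectors fun x hx => ?_
    choose α hα hx using hx
    change lieForm X ψ x = 0
    obtain ⟨X, hX⟩ := X
    obtain ⟨Y, hY, Z, hZ, rfl⟩ := Submodule.mem_sup.1 hX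
    let Y' : P.parabolic.toLieSuperalgebra.even := ⟨Y, Submodule.mem_sup_left hY⟩
    let Z' : P.parabolic.toLieSuperalgebra.even := ⟨Z, Submodule.mem_sup_right hZ⟩
    change lieForm (Y' + Z') ψ x = 0
    have hZ0 : lieForm Z' ψ x = 0 := by
      rw [lieForm_apply]
      refine Finset.sum_eq_zero fun i _ => hψ0 _ i ?_
      rw [Function.update_self]
      exact P.uEven_lie_bOdd hZ (x i).2
    rw [lieForm_add, _root_.add_apply, hZ0, add_zero]
    refine (lieForm_apply_of_eigen (X := Y') ψ (c := fun i => α i ⟨Y, hY⟩)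
      (fun i => Subtype.ext (hx i ⟨Y, hY⟩))).trans ?_
    -- With an argument in `𝔲₁` the extension vanishes; with all arguments in `𝔣₁` it is `φ`, and
    -- differentiating the `T₀`-invariance of `φ` along the curve of `Y` gives the claim.
    by_cases hk : ∃ k, P.𝓗 (α k) < 0
    · obtain ⟨k, hk⟩ := hk
      rw [hψ0 x k (P.oddWeight_le_uOdd hk (hx k)), mul_zero]
    · push Not at hk
      have hf : ∀ i, (x i).1 ∈ C.detectingOdd x₀ := fun i =>
        P.oddWeight_le_detectingOdd ((hα i).antisymm (hk i)) (hx i)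
      have hψx : ψ x = φ fun i => ⟨(x i).1, hf i⟩ := congrArg φ (funext fun i => hπ (x i) (hf i))
      rw [hψx]
      obtain ⟨c, hcT, hc⟩ := T.exists_curve hY
      refine mul_eq_zero_of_exp_mul_eq fun s => ?_
      exact (P.pullForm_torusHom_apply hY hc s (hcT s) φ hx).symm.trans
        (DFunLike.congr_fun (hT (c s) (hcT s)) _)
  · ext x
    exact congrArg φ (funext fun i => hπ (P.detectingInclusion.odd (x i)) (x i).2)

theorem isCup_res {p q : ℕ} {a : P.parabolic.toLieSuperalgebra.H p}
    {b : P.parabolic.toLieSuperalgebra.H q} {c : P.parabolic.toLieSuperalgebra.H (p + q)}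
    (h : P.parabolic.toLieSuperalgebra.IsCup a b c) :
    (C.detecting x₀).toLieSuperalgebra.IsCup (P.res p a) (P.res q b) (P.res (p + q) c) :=
  P.detectingInclusion.pullback_isCup h

theorem range_res (n : ℕ) : LinearMap.range (P.res n) = P.invariants n := by
  refine le_antisymm ?_ fun a ha => ?_
  · rintro _ ⟨a, rfl⟩
    exact P.res_mem_invariants a
  · obtain ⟨φ, rfl⟩ := (H.mk_bijective n).2 a
    obtain ⟨ψ, hψ, e⟩ := P.exists_extension φ.2.1 ((P.mk_mem_invariants_iff φ).1 ha)
    exact ⟨H.mk _ ⟨ψ, mem_cocycles_iff.2 hψ⟩, congrArg (H.mk _) (Subtype.ext e)⟩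

end ParabolicFunctional

end MaximalTorus

end ClassicalStructure

end

open LieSuperalgebra ClassicalStructure in
theorem theorem3p1 (𝔤 : LieSuperalgebra.{u}) (C : ClassicalStructure 𝔤) (T : C.MaximalTorus)
    (x₀ : 𝔤.odd) (P : T.ParabolicFunctional x₀) :
    -- (a) `H^•(𝔣, 𝔣₀; ℂ) ≅ S^•(𝔣₁^*)` as graded algebras
    (∃ e : ∀ n : ℕ, symPower (C.detecting x₀).odd n ≃ₗ[ℂ]
        (C.detecting x₀).toLieSuperalgebra.H n,
      ∀ (p q : ℕ) (a : symPower (C.detecting x₀).odd p) (b : symPower (C.detecting x₀).odd q)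
        (c : symPower (C.detecting x₀).odd (p + q)),
        (c : SymmetricAlgebra ℂ (Module.Dual ℂ (C.detecting x₀).odd)) = a * b →
          (C.detecting x₀).toLieSuperalgebra.IsCup (e p a) (e q b) (e (p + q) c)) ∧
    -- (b) the restriction map is an isomorphism onto `H^•(𝔣, 𝔣₀; ℂ)^{T₀}`
    (∀ n : ℕ, Function.Injective (P.res n) ∧ LinearMap.range (P.res n) = P.invariants n) ∧
    (∀ (p q : ℕ) (a : P.parabolic.toLieSuperalgebra.H p) (b : P.parabolic.toLieSuperalgebra.H q)
      (c : P.parabolic.toLieSuperalgebra.H (p + q)),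
      P.parabolic.toLieSuperalgebra.IsCup a b c →
        (C.detecting x₀).toLieSuperalgebra.IsCup (P.res p a) (P.res q b) (P.res (p + q) c)) := by
  have := C.finOdd
  have : FiniteDimensional ℂ (C.detecting x₀).toLieSuperalgebra.odd :=
    inferInstanceAs (FiniteDimensional ℂ (C.detectingOdd x₀))
  exact ⟨exists_symPower_equiv_H _ P.lie_detecting_eq_zero,
    fun n => ⟨P.res_injective n, P.range_res n⟩, fun _ _ _ _ _ => P.isCup_res⟩
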